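/- Let $d\ge 1$, $2\le k\le d+1$ and $l\ge 0$ be integers; if $k=d+1$, assume $l\le 1$. Let $\mathbb S^{d-1}$ be the unit sphere of $\mathbb R^d$ and $\sigma$ its uniform probability measure. For $h\ge 2$ let $P_l^h$ be the Gegenbauer polynomial of degree $l$, i.e. the polynomial of degree $l$ orthogonal on $[-1,1]$, with respect to $(1-t^2)^{(h-3)/2}\,dt$, to all polynomials of degree less than $l$, normalized by $P_l^h(1)=1$; put $P_0^1=1$, $P_1^1(t)=t$. For $x_1,\dots,x_k\in\mathbb S^{d-1}$ let $W$ be the Gram matrix of $x_3,\dots,x_k$ (with $\det W=1$ if $k=2$), and let $y_1,y_2$ be the orthogonal projections of $x_1,x_2$ onto the orthogonal complement of $\operatorname{span}\{x_3,\dots,x_k\}$. Define $$Q^d_{k,l}(x_1,\dots,x_k)=\det(W)^l\,\|y_1\|^l\,\|y_2\|^l\,P_l^{d-k+2}\!\left(\left\langle \tfrac{y_1}{\|y_1\|},\tfrac{y_2}{\|y_2\|}\right\rangle\right),$$ where for $l\ge1$ the value is $0$ if $y_1=0$ or $y_2=0$ (it is also $0$ if $x_3,\dots,x_k$ are linearly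 dependent), and $Q^d_{k,0}=1$ everywhere. Then: 1. there is a polynomial $p$ with real coefficients, depending only on $d,k,l$, such that $Q^d_{k,l}(x_1,\dots,x_k)=p\big((\langle x_i,x_j\rangle)_{1\le i,j\le k}\big)$ for all $x_1,\dots,x_k\in\mathbb S^{d-1}$; 2. $Q^d_{k,l}(Ux_1,\dots,Ux_k)=Q^d_{k,l}(x_1,\dots,x_k)$ for every orthogonal transformation $U$ of $\mathbb R^d$; 3. $Q^d_{k,l}$ is $k$-positive definite: it is continuous, symmetric in $x_1,x_2$, and for all $z_3,\dots,z_k\in\mathbb S^{d-1}$ and every finite signed Borel measure $\nu$ on $\mathbb S^{d-1}$, $$\int_{\mathbb S^{d-1}}\int_{\mathbb S^{d-1}} Q^d_{k,l}(x,y,z_3,\dots,z_k)\,d\nu(x)\,d\nu(y)\ge 0;$$ 4. $\sigma$ minimizes the energy $$I_{Q^d_{k,l}}(\mu)=\int_{\mathbb S^{d-1}}\cdots\int_{\mathbb S^{d-1}}Q^d_{k,l}(x_1,\dots,x_k)\,d\mu(x_1)\cdots d\mu(x_k)$$ among all Borel probability measures $\mu$ on $\mathbb S^{d-1}$. -/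

import Mathlib

open MeasureTheory

noncomputable section

namespace KPoint

/-! ### Gegenbauer polynomials -/

/-- The Gegenbauer polynomial `P_l^h` of degree `l` attached to the unit sphere of `ℝ^h`, normalized
by `P_l^h(1) = 1`, given by the three term recurrence
`(l + h - 1) P_{l+2} = (2 l + h) t P_{l+1} - (l + 1) P_l`, `P_0 = 1`, `P_1 = t`.
For `h ≥ 2` the theorem `gegenbauer_spec` below checks the defining properties: degree `l`,
value `1` at `1`, and orthogonality on `[-1, 1]` for the weight `(1 - t ^ 2) ^ ((h - 3) / 2)`.
For `h = 1` only the values `P_0^1 = 1` and `P_1^1 = t` are meaningful. -/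
def gegenbauer (h : ℕ) : ℕ → Polynomial ℝ
  | 0 => 1
  | 1 => Polynomial.X
  | l + 2 =>
      Polynomial.C ((2 * l + h) / (l + h - 1) : ℝ) * Polynomial.X * gegenbauer h (l + 1)
        - Polynomial.C ((l + 1) / (l + h - 1) : ℝ) * gegenbauer h l

lemma gegenbauer_rec {h : ℕ} (hh : 2 ≤ h) (l : ℕ) (t : ℝ) :
    (l + h - 1 : ℝ) * (gegenbauer h (l + 2)).eval t
      = (2 * l + h) * t * (gegenbauer h (l + 1)).eval t - (l + 1) * (gegenbauer h l).eval t := by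
  have h2 : (2 : ℝ) ≤ h := by exact_mod_cast hh
  have hl : (0 : ℝ) ≤ l := l.cast_nonneg
  have hne : (l + h - 1 : ℝ) ≠ 0 := by linarith
  rw [gegenbauer]
  simp only [Polynomial.eval_sub, Polynomial.eval_mul, Polynomial.eval_C, Polynomial.eval_X]
  field_simp

lemma gegenbauer_rec_deriv {h : ℕ} (hh : 2 ≤ h) (l : ℕ) (t : ℝ) :
    (l + h - 1 : ℝ) * (gegenbauer h (l + 2)).derivative.eval t
      = (2 * l + h) * ((gegenbauer h (l + 1)).eval t
          + t * (gegenbauer h (l + 1)).derivative.eval t)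
        - (l + 1) * (gegenbauer h l).derivative.eval t := by
  have h2 : (2 : ℝ) ≤ h := by exact_mod_cast hh
  have hl : (0 : ℝ) ≤ l := l.cast_nonneg
  have hne : (l + h - 1 : ℝ) ≠ 0 := by linarith
  rw [gegenbauer]
  simp only [Polynomial.derivative_sub, Polynomial.derivative_mul, Polynomial.derivative_C,
    Polynomial.derivative_X, Polynomial.eval_sub, Polynomial.eval_add,
    Polynomial.eval_mul, Polynomial.eval_C, Polynomial.eval_X, zero_mul, zero_add, mul_one]
  field_simp

lemma gegenbauer_deriv {h : ℕ} (hh : 2 ≤ h) (l : ℕ) (t : ℝ) :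
    (1 - t ^ 2) * (gegenbauer h l).derivative.eval t
        = (l + h - 2) * (t * (gegenbauer h l).eval t - (gegenbauer h (l + 1)).eval t) ∧
    (1 - t ^ 2) * (gegenbauer h (l + 1)).derivative.eval t
        = (l + 1) * ((gegenbauer h l).eval t - t * (gegenbauer h (l + 1)).eval t) := by
  have h2 : (2 : ℝ) ≤ h := by exact_mod_cast hh
  induction l with
  | zero => constructor <;> simp [gegenbauer]; ring
  | succ l ih =>
    obtain ⟨ih1, ih2⟩ := ih
    have hl : (0 : ℝ) ≤ l := l.cast_nonneg
    have hne : (l + h - 1 : ℝ) ≠ 0 := by linarith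
    have r := gegenbauer_rec hh l t
    have r' := gegenbauer_rec_deriv hh l t
    push_cast
    constructor
    · linear_combination ih2 + r
    · apply mul_left_cancel₀ hne
      linear_combination (1 - t ^ 2) * r' + (2 * l + h) * t * ih2 - (l + 1) * ih1
        + (l + 2) * t * r

lemma gegenbauer_intervalIntegrable {h : ℕ} (hh : 2 ≤ h) (q : Polynomial ℝ) :
    IntervalIntegrable (fun t : ℝ => q.eval t * (1 - t ^ 2) ^ (((h : ℝ) - 3) / 2)) volume (-1) 1 := by
  apply IntervalIntegrable.continuousOn_mul _ q.continuous.continuousOn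
  rcases hh.eq_or_lt with rfl | h3
  · refine Polynomial.Chebyshev.intervalIntegrable_sqrt_one_sub_sq_inv.congr ?_
    intro t ht
    rw [Set.uIoc_of_le (by norm_num)] at ht
    have : (0 : ℝ) ≤ 1 - t ^ 2 := by nlinarith [ht.1, ht.2]
    simp only [Real.sqrt_inv]
    rw [Real.sqrt_eq_rpow, ← Real.rpow_neg this]
    norm_num
  · have h3' : (3 : ℝ) ≤ h := by exact_mod_cast h3
    refine ContinuousOn.intervalIntegrable (Continuous.continuousOn ?_)
    exact Continuous.rpow_const (by fun_prop) (fun _ => Or.inr (by linarith))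

lemma gegenbauer_integral_zero {h : ℕ} (hh : 2 ≤ h) (l : ℕ) :
    ∫ t in (-1 : ℝ)..1, (gegenbauer h (l + 1)).eval t * (1 - t ^ 2) ^ (((h : ℝ) - 3) / 2) = 0 := by
  have h2 : (2 : ℝ) ≤ h := by exact_mod_cast hh
  have hl : (0 : ℝ) ≤ l := l.cast_nonneg
  set P := gegenbauer h (l + 1) with hP
  have key := intervalIntegral.integral_eq_sub_of_hasDerivAt_of_le (a := (-1 : ℝ)) (b := 1)
    (f := fun t => (1 - t ^ 2) ^ (((h : ℝ) - 1) / 2) * P.derivative.eval t)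
    (f' := fun t => -((l + 1) * (l + h - 1)) * (P.eval t * (1 - t ^ 2) ^ (((h : ℝ) - 3) / 2)))
    (by norm_num)
    (((Continuous.rpow_const (by fun_prop) (fun _ => Or.inr (by linarith))).mul
      P.derivative.continuous).continuousOn)
    (fun t ht => by
      have hpos : (0 : ℝ) < 1 - t ^ 2 := by nlinarith [ht.1, ht.2]
      have d1 : HasDerivAt (fun t : ℝ => 1 - t ^ 2) (-(2 * t)) t := by
        simpa using (hasDerivAt_pow 2 t).const_sub 1
      have d2 := (d1.rpow_const (p := ((h : ℝ) - 1) / 2) (Or.inl hpos.ne')).mul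
        (P.derivative.hasDerivAt t)
      refine HasDerivAt.congr_deriv (f' := _) d2 ?_
      have e1 : ((h : ℝ) - 1) / 2 - 1 = ((h : ℝ) - 3) / 2 := by ring
      have e2 : (1 - t ^ 2) ^ (((h : ℝ) - 1) / 2)
          = (1 - t ^ 2) ^ (((h : ℝ) - 3) / 2) * (1 - t ^ 2) := by
        rw [← Real.rpow_add_one hpos.ne']; congr 1; ring
      rw [e1, e2]
      -- differentiate the first order relation
      obtain ⟨A, B⟩ := gegenbauer_deriv hh l t
      have hpoly : (1 - Polynomial.X ^ 2) * P.derivative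
          = Polynomial.C (l + 1 : ℝ) * (gegenbauer h l - Polynomial.X * P) := by
        apply Polynomial.funext
        intro s
        have := (gegenbauer_deriv hh l s).2
        simpa using this
      have hd := congrArg (fun q => (Polynomial.derivative q).eval t) hpoly
      simp only [Polynomial.derivative_mul, Polynomial.derivative_sub, Polynomial.derivative_one,
        Polynomial.derivative_X_pow, Polynomial.derivative_C, Polynomial.derivative_X,
        Polynomial.eval_add, Polynomial.eval_sub, Polynomial.eval_mul, Polynomial.eval_one,
        Polynomial.eval_C, Polynomial.eval_X, Polynomial.eval_pow, Polynomial.eval_zero] at hd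
      norm_num at hd
      rw [← hP] at B
      have ode : (1 - t ^ 2) * P.derivative.derivative.eval t
          = ((h : ℝ) - 1) * t * P.derivative.eval t
            - (l + 1) * (l + h - 1) * P.eval t := by
        apply mul_left_cancel₀ hpos.ne'
        linear_combination (1 - t ^ 2) * hd + (l + 1) * A - (l + h - 2) * t * B
      linear_combination (1 - t ^ 2) ^ (((h : ℝ) - 3) / 2) * ode)
    ((gegenbauer_intervalIntegrable hh P).const_mul _)
  rw [intervalIntegral.integral_const_mul] at key
  have h0 : ((h : ℝ) - 1) / 2 ≠ 0 := by
    have : (0 : ℝ) < ((h : ℝ) - 1) / 2 := by linarith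
    exact this.ne'
  have hc : -((l + 1) * (l + h - 1) : ℝ) ≠ 0 := by
    have : (0 : ℝ) < (l + 1) * (l + h - 1) := by
      apply mul_pos <;> linarith
    linarith
  norm_num [Real.zero_rpow h0] at key
  rcases key with (hk | hk) | hk
  · linarith
  · linarith
  · exact hk

lemma gegenbauer_integral_pow {h : ℕ} (hh : 2 ≤ h) (j : ℕ) : ∀ l : ℕ, j < l →
    ∫ t in (-1 : ℝ)..1, (gegenbauer h l).eval t * t ^ j * (1 - t ^ 2) ^ (((h : ℝ) - 3) / 2) = 0 := by
  have h2 : (2 : ℝ) ≤ h := by exact_mod_cast hh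
  induction j with
  | zero =>
    intro l hl
    obtain ⟨m, rfl⟩ : ∃ m, l = m + 1 := ⟨l - 1, by omega⟩
    simpa using gegenbauer_integral_zero hh m
  | succ j ih =>
    intro l hl
    obtain ⟨m, rfl⟩ : ∃ m, l = m + 1 := ⟨l - 1, by omega⟩
    have hm : (0 : ℝ) ≤ m := m.cast_nonneg
    have hne : (2 * m + h : ℝ) ≠ 0 := by linarith
    have i1 := ih (m + 2) (by omega)
    have i2 := ih m (by omega)
    have int (l : ℕ) : IntervalIntegrable (fun t : ℝ => (gegenbauer h l).eval t * t ^ j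
        * (1 - t ^ 2) ^ (((h : ℝ) - 3) / 2)) volume (-1) 1 := by
      have := gegenbauer_intervalIntegrable hh (gegenbauer h l * Polynomial.X ^ j)
      simpa only [Polynomial.eval_mul, Polynomial.eval_pow, Polynomial.eval_X] using this
    have : (fun t : ℝ => (gegenbauer h (m + 1)).eval t * t ^ (j + 1)
        * (1 - t ^ 2) ^ (((h : ℝ) - 3) / 2)) = fun t =>
        ((m + h - 1) / (2 * m + h)) * ((gegenbauer h (m + 2)).eval t * t ^ j
          * (1 - t ^ 2) ^ (((h : ℝ) - 3) / 2))
        + ((m + 1) / (2 * m + h)) * ((gegenbauer h m).eval t * t ^ j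
          * (1 - t ^ 2) ^ (((h : ℝ) - 3) / 2)) := by
      funext t
      have r := gegenbauer_rec hh m t
      field_simp
      linear_combination (-1) * t ^ j * (1 - t ^ 2) ^ (((h : ℝ) - 3) / 2) * r
    rw [this, intervalIntegral.integral_add ((int _).const_mul _) ((int _).const_mul _),
      intervalIntegral.integral_const_mul, intervalIntegral.integral_const_mul, i1, i2]
    simp

/-- The defining properties of the normalized Gegenbauer polynomials of index `h ≥ 2`. -/
theorem gegenbauer_spec {h : ℕ} (hh : 2 ≤ h) (l : ℕ) :
    (gegenbauer h l).natDegree = l ∧ (gegenbauer h l).eval 1 = 1 ∧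
    ∀ q : Polynomial ℝ, q.degree < l →
      ∫ t in (-1 : ℝ)..1,
        (gegenbauer h l).eval t * q.eval t * (1 - t ^ 2) ^ (((h : ℝ) - 3) / 2) = 0 := by
  have h2 : (2 : ℝ) ≤ h := by exact_mod_cast hh
  refine ⟨?_, ?_, ?_⟩
  · have : ∀ l, (gegenbauer h l).natDegree = l ∧ (gegenbauer h (l + 1)).natDegree = l + 1 := by
      intro l
      induction l with
      | zero => simp [gegenbauer]
      | succ l ih =>
        refine ⟨ih.2, ?_⟩
        have hl : (0 : ℝ) ≤ l := l.cast_nonneg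
        have hc : ((2 * l + h) / (l + h - 1) : ℝ) ≠ 0 := by
          apply div_ne_zero <;> linarith
        have hne : gegenbauer h (l + 1) ≠ 0 := by
          intro h0
          have := ih.2
          rw [h0] at this
          simp at this
        have hd : (Polynomial.C ((2 * l + h) / (l + h - 1) : ℝ) * Polynomial.X
            * gegenbauer h (l + 1)).natDegree = l + 2 := by
          rw [mul_assoc, Polynomial.natDegree_C_mul hc, Polynomial.natDegree_X_mul hne, ih.2]
        rw [gegenbauer, Polynomial.natDegree_sub_eq_left_of_natDegree_lt, hd]
        rw [hd]
        exact (Polynomial.natDegree_C_mul_le _ _).trans_lt (by rw [ih.1]; omega)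
    exact (this l).1
  · have : ∀ l, (gegenbauer h l).eval 1 = 1 ∧ (gegenbauer h (l + 1)).eval 1 = 1 := by
      intro l
      induction l with
      | zero => simp [gegenbauer]
      | succ l ih =>
        refine ⟨ih.2, ?_⟩
        have hl : (0 : ℝ) ≤ l := l.cast_nonneg
        have hne : (l + h - 1 : ℝ) ≠ 0 := by linarith
        have r := gegenbauer_rec hh l 1
        rw [ih.1, ih.2] at r
        apply mul_left_cancel₀ hne
        linear_combination r
    exact (this l).1
  · intro q hq
    have e : (fun t : ℝ => (gegenbauer h l).eval t * q.eval t * (1 - t ^ 2) ^ (((h : ℝ) - 3) / 2))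
        = fun t => ∑ j ∈ Finset.range l, q.coeff j * ((gegenbauer h l).eval t * t ^ j
          * (1 - t ^ 2) ^ (((h : ℝ) - 3) / 2)) := by
      funext t
      by_cases hq0 : q = 0
      · simp [hq0]
      rw [Polynomial.eval_eq_sum_range' ((Polynomial.natDegree_lt_iff_degree_lt hq0).2 hq),
        Finset.mul_sum, Finset.sum_mul]
      exact Finset.sum_congr rfl fun j _ => by ring
    rw [e, intervalIntegral.integral_finsetSum]
    · refine Finset.sum_eq_zero fun j hj => ?_
      rw [intervalIntegral.integral_const_mul,
        gegenbauer_integral_pow hh j l (Finset.mem_range.1 hj), mul_zero]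
    · intro j _
      have := gegenbauer_intervalIntegrable hh (gegenbauer h l * Polynomial.X ^ j)
      simp only [Polynomial.eval_mul, Polynomial.eval_pow, Polynomial.eval_X] at this
      exact this.const_mul _

/-! ### The sphere, measures and energies -/

/-- Euclidean space `ℝ^d`. -/
abbrev Euc (d : ℕ) : Type := EuclideanSpace ℝ (Fin d)

/-- The unit sphere `𝕊^{d-1}` of `ℝ^d`. -/
abbrev Sph (d : ℕ) : Type := Metric.sphere (0 : Euc d) 1

/-- The uniform probability measure `σ` on `𝕊^{d-1}`: the normalized surface measure. -/
def sigma (d : ℕ) : Measure (Sph d) :=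
  ((volume : Measure (Euc d)).toSphere Set.univ)⁻¹ • (volume : Measure (Euc d)).toSphere

/-- The `k`-input energy `I_K(μ)`: the integral of `K(x_1, …, x_k)` against `μ ⊗ ⋯ ⊗ μ`. -/
def energy {d k : ℕ} (K : (Fin k → Sph d) → ℝ) (μ : Measure (Sph d)) : ℝ :=
  ∫ x, K x ∂(Measure.pi fun _ => μ)

/-- `μ` minimizes `I_K` over all Borel probability measures on the sphere. -/
def IsEnergyMinimizer {d k : ℕ} (K : (Fin k → Sph d) → ℝ) (μ : Measure (Sph d)) : Prop :=
  IsProbabilityMeasure μ ∧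
    ∀ ν : Measure (Sph d), IsProbabilityMeasure ν → energy K μ ≤ energy K ν

/-! ### Positive definiteness

A kernel with `k ≥ 2` inputs is a function on `Fin (n + 2) → Sph d`, with `k = n + 2`; the inputs
`x_1, x_2` are `x 0, x 1`, and `x_3, …, x_k` are the remaining `n` entries. -/

/-- The integral of a real function against a finite signed measure. -/
def signedIntegral {X : Type*} [MeasurableSpace X] (ν : SignedMeasure X) (f : X → ℝ) : ℝ :=
  ν.integral f (ContinuousLinearMap.lsmul ℝ ℝ).flip

/-- A two-input kernel is positive definite if it is symmetric and
`∫ ∫ U(x, y) dν(x) dν(y) ≥ 0` for every finite signed Borel measure `ν`. -/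
def IsPositiveDefinite {d : ℕ} (U : Sph d → Sph d → ℝ) : Prop :=
  (∀ x y, U x y = U y x) ∧
    ∀ ν : SignedMeasure (Sph d), 0 ≤ signedIntegral ν fun y => signedIntegral ν fun x => U x y

/-- The potential function `U_K^{z_3, …, z_k}(x, y) = K(x, y, z_3, …, z_k)`. -/
def potential {d n : ℕ} (K : (Fin (n + 2) → Sph d) → ℝ) (z : Fin n → Sph d) (x y : Sph d) : ℝ :=
  K (Matrix.vecCons x (Matrix.vecCons y z))

/-- `K` is `k`-positive definite (`k = n + 2`): it is continuous and, for any fixed last `k - 2`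
inputs, its potential function is (symmetric and) positive definite in the first two. -/
def IsKPositiveDefinite {d n : ℕ} (K : (Fin (n + 2) → Sph d) → ℝ) : Prop :=
  Continuous K ∧ ∀ z : Fin n → Sph d, IsPositiveDefinite (potential K z)

/-- Invariance under simultaneous action of any orthogonal transformation on all inputs. -/
def IsRotationInvariant {d k : ℕ} (K : (Fin k → Sph d) → ℝ) : Prop :=
  ∀ (U : Euc d ≃ₗᵢ[ℝ] Euc d) (x x' : Fin k → Sph d),
    (∀ i, (x' i : Euc d) = U (x i : Euc d)) → K x' = K x

/-- `K` is a polynomial in the inner products of its inputs. -/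
def IsPolynomialKernel {d k : ℕ} (K : (Fin k → Sph d) → ℝ) : Prop :=
  ∃ p : MvPolynomial (Fin k × Fin k) ℝ, ∀ x : Fin k → Sph d,
    K x = MvPolynomial.eval (fun ij => inner ℝ (x ij.1 : Euc d) (x ij.2 : Euc d)) p

/-! ### The kernels `Q_{k,l}^d` -/

/-- The last `k - 2` inputs `x_3, …, x_k`, as vectors of `ℝ^d`. -/
def lastInputs {d n : ℕ} (x : Fin (n + 2) → Sph d) : Fin n → Euc d :=
  fun i => (x i.succ.succ : Euc d)

/-- The orthogonal projection of `v` onto the orthogonal complement of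
`X = span {x_3, …, x_k}`. -/
def perp {d n : ℕ} (x : Fin (n + 2) → Sph d) (v : Euc d) : Euc d :=
  (Submodule.span ℝ (Set.range (lastInputs x)))ᗮ.starProjection v

/-- The kernel `Q_{k,l}^d` with `k = n + 2`, so that `d - k + 2 = d - n`:
`det(W)^l ‖y_1‖^l ‖y_2‖^l P_l^{d-k+2}(⟨y_1/‖y_1‖, y_2/‖y_2‖⟩)`, where `W` is the Gram matrix of
`x_3, …, x_k` and `y_i` is the projection of `x_i` orthogonal to their span. At degenerate inputs
(`det W = 0`, `y_1 = 0` or `y_2 = 0`) the prefactor makes the value `0` if `l ≥ 1`, and the value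
is `1` everywhere if `l = 0`. -/
def Q (d n l : ℕ) (x : Fin (n + 2) → Sph d) : ℝ :=
  (Matrix.gram ℝ (lastInputs x)).det ^ l
    * ‖perp x (x 0 : Euc d)‖ ^ l * ‖perp x (x 1 : Euc d)‖ ^ l
    * (gegenbauer (d - n) l).eval
        (inner ℝ ((‖perp x (x 0 : Euc d)‖⁻¹ : ℝ) • perp x (x 0 : Euc d))
          ((‖perp x (x 1 : Euc d)‖⁻¹ : ℝ) • perp x (x 1 : Euc d)))

end KPoint

end

/-!
Write `h = d - n` for the dimension of the orthogonal complement `V` of the last inputs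
`z = (x_3, …, x_k)`, and let `G_l(s, w)` be the homogenization of `P_l^h` (`gegHom`), so that
`Q(x, y, z) = det(W)^l G_l(⟨Px, Py⟩, ‖Px‖² ‖Py‖²)` with `P` the projection to `V` (`Q_eq_gegHom`).

*Polynomiality.* As `G_l` is weighted homogeneous, the powers of `det W` can be moved into its
arguments, and `det(W) ⟨Px_i, Px_j⟩` is the determinant of the Gram matrix of `z` bordered by `x_i`
and `x_j` (`det_borderedGram`), also when `z` is dependent. So `Q` is a polynomial in the inner
products; continuity and rotation invariance follow.

*Positive definiteness.* In coordinates of `V`, `G_l(⟨x, y⟩, ‖x‖² ‖y‖²)` is a polynomial `Z_l` in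
two vector variables (`zonal`). The raising operators `A_i = x_i - a ‖x‖² ∂_i`, with
`a = (h + 2 l - 2)⁻¹`, map harmonic polynomials of degree `l` to harmonic ones of degree `l + 1`,
and `∑ i, A_i^x A_i^y Z_l` is a positive multiple of `Z_{l+1}` (`sum_raise_zonal`). The
latter comes down to the formulas for `∑ y_i ∂/∂x_i`, `∑ x_i ∂/∂y_i` and `∑ ∂²/∂x_i∂y_i` on `Z_l`,
which follow from the three term recurrence by induction. Hence `Z_l(x, y) = c ∑ f_m(x) f_m(y)` with `c ≥ 0` and
harmonic `f_m` (`zonal_eq_sum`), so that double integrals of `Q` against `ν ⊗ ν` are nonnegative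
combinations of squares.

*Energy.* By Fubini the energy of every measure is nonnegative, and for `l ≥ 1` that of `σ` is zero:
`e ↦ ∫ Z_l(e, Px) dσ(x)` is a harmonic polynomial on `V`, which is constant on the unit sphere of
`V` because reflections that preserve `V` preserve `σ`; such a polynomial vanishes
(`IsHarmonicHom.eq_zero_of_sphere`, `integral_zonal_eq_zero`). For `l = 0` the kernel is constant.
-/

open MeasureTheory

noncomputable section

namespace KPoint

open MvPolynomial

/-! ### The homogenized Gegenbauer polynomial -/

section Homogenization

variable {R S : Type*} [CommRing R] [Algebra ℝ R] [CommRing S] [Algebra ℝ S]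

/-- The homogenization `w ^ (l / 2) P_l^h (s / √w)` of the Gegenbauer polynomial, for `s` of
weight `1` and `w` of weight `2` in an arbitrary commutative real algebra. It is defined by the
homogenized three term recurrence, so no square root or division in `R` is involved. -/
def gegHom (h : ℕ) (s w : R) : ℕ → R
  | 0 => 1
  | 1 => s
  | l + 2 => ((2 * l + h) / (l + h - 1) : ℝ) • (s * gegHom h s w (l + 1))
      - ((l + 1) / (l + h - 1) : ℝ) • (w * gegHom h s w l)

lemma map_gegHom (f : R →ₐ[ℝ] S) (h : ℕ) (s w : R) (l : ℕ) :
    f (gegHom h s w l) = gegHom h (f s) (f w) l := by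
  induction l using Nat.twoStepInduction with
  | zero => simp [gegHom]
  | one => simp [gegHom]
  | more l ih₀ ih₁ => simp [gegHom, ih₀, ih₁]

/-- `gegHom` is weighted homogeneous of degree `l`. -/
lemma pow_mul_gegHom (h : ℕ) (c s w : R) (l : ℕ) :
    c ^ l * gegHom h s w l = gegHom h (c * s) (c ^ 2 * w) l := by
  induction l using Nat.twoStepInduction with
  | zero => simp [gegHom]
  | one => simp [gegHom]
  | more l ih₀ ih₁ =>
    simp only [gegHom, ← ih₀, ← ih₁, mul_sub, mul_smul_comm]
    congr 2 <;> ring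

lemma pow_mul_gegenbauer_eval (h l : ℕ) (a t : ℝ) :
    a ^ l * (gegenbauer h l).eval t = gegHom h (a * t) (a ^ 2) l := by
  induction l using Nat.twoStepInduction with
  | zero => simp [gegHom, gegenbauer]
  | one => simp [gegHom, gegenbauer]
  | more l ih₀ ih₁ =>
    simp only [gegHom, gegenbauer, ← ih₀, ← ih₁, smul_eq_mul, Polynomial.eval_sub,
      Polynomial.eval_mul, Polynomial.eval_C, Polynomial.eval_X]
    ring

/-- The recurrence with coefficients cleared of denominators. -/
lemma gegHom_rec {h : ℕ} (hh : 2 ≤ h) (s w : R) (l : ℕ) :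
    (l + h - 1 : R) * gegHom h s w (l + 2)
      = (2 * l + h) * s * gegHom h s w (l + 1) - (l + 1) * w * gegHom h s w l := by
  have hne : (l + h - 1 : ℝ) ≠ 0 := by
    have : (2 : ℝ) ≤ h := by exact_mod_cast hh
    have := l.cast_nonneg (α := ℝ)
    linarith
  have e : (l + h - 1 : R) = algebraMap ℝ R (l + h - 1) := by simp
  rw [gegHom, e, mul_sub, ← Algebra.smul_def, ← Algebra.smul_def, smul_smul, smul_smul,
    mul_div_cancel₀ _ hne, mul_div_cancel₀ _ hne, Algebra.smul_def, Algebra.smul_def]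
  simp only [map_add, map_mul, map_natCast, map_ofNat, map_one]
  ring

/-- The leading coefficient of the recurrence is a nonzero real, so it can be cancelled in `R`. -/
lemma cancel_rec_coeff {h : ℕ} (hh : 2 ≤ h) (l : ℕ) {a b : R}
    (H : (l + h - 1 : R) * a = (l + h - 1) * b) : a = b := by
  have hne : (l + h - 1 : ℝ) ≠ 0 := by
    have : (2 : ℝ) ≤ h := by exact_mod_cast hh
    have := l.cast_nonneg (α := ℝ)
    linarith
  have e : (l + h - 1 : R) = algebraMap ℝ R (l + h - 1) := by simp
  rw [e, ← Algebra.smul_def, ← Algebra.smul_def] at H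
  exact (IsUnit.mk0 _ hne).smul_left_cancel.1 H

/-- The recurrence solved for its lowest term. It holds for `l = 0` as well: the term
`gegHom h s w (0 - 1)` then has the factor `0`. -/
lemma mul_gegHom_pred {h : ℕ} (hh : 2 ≤ h) (s w : R) (l : ℕ) :
    (l : R) * w * gegHom h s w (l - 1)
      = (2 * l + h - 2) * s * gegHom h s w l - (l + h - 2) * gegHom h s w (l + 1) := by
  cases l with
  | zero => simp [gegHom]
  | succ l =>
    have := gegHom_rec hh s w l
    rw [Nat.add_sub_cancel]
    push_cast
    linear_combination this

lemma derivation_gegHom_rec {h : ℕ} (hh : 2 ≤ h) (D : Derivation ℝ R R) (s w : R) (l : ℕ) :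
    (l + h - 1 : R) * D (gegHom h s w (l + 2))
      = (2 * l + h) * (D s * gegHom h s w (l + 1) + s * D (gegHom h s w (l + 1)))
        - (l + 1) * (D w * gegHom h s w l + w * D (gegHom h s w l)) := by
  have r := congrArg D (gegHom_rec hh s w l)
  have hn (n : ℕ) : D (n : R) = 0 := D.map_natCast n
  have h2 : D (2 : R) = 0 := by simpa using hn 2
  simp only [map_sub, map_add, Derivation.leibniz, smul_eq_mul, hn, h2, D.map_one_eq_zero] at r
  linear_combination r

/-- A derivation acting on `s, w` like `∑ yᵢ ∂/∂xᵢ` on `⟨x, y⟩` and `‖x‖² ‖y‖²` (where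
`v = ‖y‖²`) lowers the degree of the homogenized Gegenbauer polynomial by one. -/
lemma derivation_gegHom {h : ℕ} (hh : 2 ≤ h) (D : Derivation ℝ R R) {s w v : R}
    (hs : D s = v) (hw : D w = 2 * s * v) (l : ℕ) :
    D (gegHom h s w l) = l * v * gegHom h s w (l - 1) := by
  induction l using Nat.twoStepInduction with
  | zero => simp [gegHom]
  | one => simp [gegHom, hs]
  | more l ih₀ ih₁ =>
    apply cancel_rec_coeff hh l
    have r := derivation_gegHom_rec hh D s w l
    have p := mul_gegHom_pred hh s w l
    rw [ih₀, ih₁, hs, hw] at r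
    rw [r]
    simp only [Nat.add_sub_cancel, show l + 2 - 1 = l + 1 by omega]
    push_cast
    linear_combination (-(l + 1) * v) * p

/-- The Euler derivation in one of the two vector variables. -/
lemma euler_gegHom {h : ℕ} (hh : 2 ≤ h) (D : Derivation ℝ R R) {s w : R}
    (hs : D s = s) (hw : D w = 2 * w) (l : ℕ) :
    D (gegHom h s w l) = l * gegHom h s w l := by
  induction l using Nat.twoStepInduction with
  | zero => simp [gegHom]
  | one => simp [gegHom, hs]
  | more l ih₀ ih₁ =>
    apply cancel_rec_coeff hh l
    have r := derivation_gegHom_rec hh D s w l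
    have p := gegHom_rec hh s w l
    rw [ih₀, ih₁, hs, hw] at r
    rw [r]
    push_cast
    linear_combination (-(l + 2) : R) * p

end Homogenization

/-! ### The zonal polynomial in two vector variables -/

lemma pderiv_inl_rename_inr {ι : Type*} (i : ι) (p : MvPolynomial ι ℝ) :
    pderiv (Sum.inl i : ι ⊕ ι) (rename Sum.inr p) = 0 := by
  classical
  apply pderiv_eq_zero_of_notMem_vars
  intro h
  have := vars_rename _ _ h
  simp at this

lemma pderiv_inr_rename_inl {ι : Type*} (i : ι) (p : MvPolynomial ι ℝ) :
    pderiv (Sum.inr i : ι ⊕ ι) (rename Sum.inl p) = 0 := by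
  classical
  apply pderiv_eq_zero_of_notMem_vars
  intro h
  have := vars_rename _ _ h
  simp at this

section Zonal

variable {ι : Type*} [Fintype ι]

/-- The bilinear form `∑ xᵢ yᵢ` as a polynomial in `x` (left variables) and `y` (right ones). -/
def dotPoly (ι : Type*) [Fintype ι] : MvPolynomial (ι ⊕ ι) ℝ := ∑ i, X (.inl i) * X (.inr i)

/-- The squared norm `∑ xᵢ ^ 2` as a polynomial. -/
def normSqPoly (ι : Type*) [Fintype ι] : MvPolynomial ι ℝ := ∑ i, X i ^ 2

/-- The coordinate `xᵢ` of the first vector variable. -/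
abbrev xVar {ι : Type*} (i : ι) : MvPolynomial (ι ⊕ ι) ℝ := X (Sum.inl i)

/-- The coordinate `yᵢ` of the second vector variable. -/
abbrev yVar {ι : Type*} (i : ι) : MvPolynomial (ι ⊕ ι) ℝ := X (Sum.inr i)

/-- The squared norm of the first vector variable. -/
abbrev normSqX (ι : Type*) [Fintype ι] : MvPolynomial (ι ⊕ ι) ℝ := rename Sum.inl (normSqPoly ι)

/-- The squared norm of the second vector variable. -/
abbrev normSqY (ι : Type*) [Fintype ι] : MvPolynomial (ι ⊕ ι) ℝ := rename Sum.inr (normSqPoly ι)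

/-- The zonal polynomial `‖x‖^l ‖y‖^l P_l^h(⟨x, y⟩ / (‖x‖ ‖y‖))`, with `h` the dimension. -/
def zonal (ι : Type*) [Fintype ι] (l : ℕ) : MvPolynomial (ι ⊕ ι) ℝ :=
  gegHom (Fintype.card ι) (dotPoly ι) (normSqX ι * normSqY ι) l

lemma pderiv_normSqPoly [DecidableEq ι] (i : ι) : pderiv i (normSqPoly ι) = 2 * X i := by
  simp [normSqPoly, Derivation.leibniz_pow, pderiv_X, Pi.single_apply, mul_comm]

lemma pderiv_inl_dotPoly (i : ι) : pderiv (Sum.inl i) (dotPoly ι) = X (.inr i) := by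
  classical
  simp [dotPoly, Derivation.leibniz, pderiv_X, Pi.single_apply]

lemma pderiv_inr_dotPoly (i : ι) : pderiv (Sum.inr i) (dotPoly ι) = X (.inl i) := by
  classical
  simp [dotPoly, Derivation.leibniz, pderiv_X, Pi.single_apply]

end Zonal

section Zonal

variable {ι : Type*} [Fintype ι]

lemma pderiv_inl_rename_normSqPoly (i : ι) :
    pderiv (Sum.inl i : ι ⊕ ι) (normSqX ι) = 2 * xVar i := by
  classical
  rw [pderiv_rename Sum.inl_injective, pderiv_normSqPoly, map_mul, map_ofNat, rename_X]

lemma pderiv_inr_rename_normSqPoly (i : ι) :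
    pderiv (Sum.inr i : ι ⊕ ι) (normSqY ι) = 2 * yVar i := by
  classical
  rw [pderiv_rename Sum.inr_injective, pderiv_normSqPoly, map_mul, map_ofNat, rename_X]

lemma rename_inl_normSqPoly : normSqX ι = ∑ i, xVar i ^ 2 := by
  simp [normSqX, normSqPoly]

lemma rename_inr_normSqPoly : normSqY ι = ∑ i, yVar i ^ 2 := by
  simp [normSqY, normSqPoly]

lemma sum_inr_mul_pderiv_inl_zonal (hh : 2 ≤ Fintype.card ι) (l : ℕ) :
    ∑ i, yVar i * pderiv (Sum.inl i) (zonal ι l)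
      = l * normSqY ι * zonal ι (l - 1) := by
  set D : Derivation ℝ (MvPolynomial (ι ⊕ ι) ℝ) (MvPolynomial (ι ⊕ ι) ℝ) :=
    ∑ i, yVar i • pderiv (Sum.inl i) with hD
  have hD' (f) : D f = ∑ i, yVar i * pderiv (Sum.inl i) f := by
    simp only [hD, ← Derivation.coeFnAddMonoidHom_apply, map_sum, Finset.sum_apply]
    rfl
  rw [← hD', zonal, zonal]
  refine derivation_gegHom hh D ?_ ?_ l
  · rw [hD', rename_inr_normSqPoly]
    exact Finset.sum_congr rfl fun i _ => by rw [pderiv_inl_dotPoly]; ring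
  · rw [hD', dotPoly, Finset.mul_sum, Finset.sum_mul]
    refine Finset.sum_congr rfl fun i _ => ?_
    rw [Derivation.leibniz, pderiv_inl_rename_inr, pderiv_inl_rename_normSqPoly]
    simp only [smul_eq_mul]
    ring

lemma sum_inl_mul_pderiv_inr_zonal (hh : 2 ≤ Fintype.card ι) (l : ℕ) :
    ∑ i, xVar i * pderiv (Sum.inr i) (zonal ι l)
      = l * normSqX ι * zonal ι (l - 1) := by
  set D : Derivation ℝ (MvPolynomial (ι ⊕ ι) ℝ) (MvPolynomial (ι ⊕ ι) ℝ) :=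
    ∑ i, xVar i • pderiv (Sum.inr i) with hD
  have hD' (f) : D f = ∑ i, xVar i * pderiv (Sum.inr i) f := by
    simp only [hD, ← Derivation.coeFnAddMonoidHom_apply, map_sum, Finset.sum_apply]
    rfl
  rw [← hD', zonal, zonal]
  refine derivation_gegHom hh D ?_ ?_ l
  · rw [hD', rename_inl_normSqPoly]
    exact Finset.sum_congr rfl fun i _ => by rw [pderiv_inr_dotPoly]; ring
  · rw [hD', dotPoly, Finset.mul_sum, Finset.sum_mul]
    refine Finset.sum_congr rfl fun i _ => ?_
    rw [Derivation.leibniz, pderiv_inr_rename_inl, pderiv_inr_rename_normSqPoly]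
    simp only [smul_eq_mul]
    ring

lemma sum_inl_mul_pderiv_inl_zonal (hh : 2 ≤ Fintype.card ι) (l : ℕ) :
    ∑ i, xVar i * pderiv (Sum.inl i) (zonal ι l) = l * zonal ι l := by
  set D : Derivation ℝ (MvPolynomial (ι ⊕ ι) ℝ) (MvPolynomial (ι ⊕ ι) ℝ) :=
    ∑ i, xVar i • pderiv (Sum.inl i) with hD
  have hD' (f) : D f = ∑ i, xVar i * pderiv (Sum.inl i) f := by
    simp only [hD, ← Derivation.coeFnAddMonoidHom_apply, map_sum, Finset.sum_apply]
    rfl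
  rw [← hD', zonal]
  refine euler_gegHom hh D ?_ ?_ l
  · rw [hD']
    conv_rhs => rw [dotPoly]
    exact Finset.sum_congr rfl fun i _ => by rw [pderiv_inl_dotPoly]
  · rw [hD']
    conv_rhs => rw [rename_inl_normSqPoly, Finset.sum_mul, Finset.mul_sum]
    refine Finset.sum_congr rfl fun i _ => ?_
    rw [Derivation.leibniz, pderiv_inl_rename_inr, pderiv_inl_rename_normSqPoly]
    simp only [smul_eq_mul]
    ring

lemma sum_inr_mul_pderiv_inr_zonal (hh : 2 ≤ Fintype.card ι) (l : ℕ) :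
    ∑ i, yVar i * pderiv (Sum.inr i) (zonal ι l) = l * zonal ι l := by
  set D : Derivation ℝ (MvPolynomial (ι ⊕ ι) ℝ) (MvPolynomial (ι ⊕ ι) ℝ) :=
    ∑ i, yVar i • pderiv (Sum.inr i) with hD
  have hD' (f) : D f = ∑ i, yVar i * pderiv (Sum.inr i) f := by
    simp only [hD, ← Derivation.coeFnAddMonoidHom_apply, map_sum, Finset.sum_apply]
    rfl
  rw [← hD', zonal]
  refine euler_gegHom hh D ?_ ?_ l
  · rw [hD']
    conv_rhs => rw [dotPoly]
    exact Finset.sum_congr rfl fun i _ => by rw [pderiv_inr_dotPoly, mul_comm]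
  · rw [hD']
    conv_rhs => rw [rename_inr_normSqPoly, Finset.mul_sum, Finset.mul_sum]
    refine Finset.sum_congr rfl fun i _ => ?_
    rw [Derivation.leibniz, pderiv_inr_rename_inl, pderiv_inr_rename_normSqPoly]
    simp only [smul_eq_mul]
    ring

/-- The mixed Laplacian `∑ ∂²/∂xᵢ∂yᵢ`. -/
def mixedLaplacian (ι : Type*) [Fintype ι] :
    MvPolynomial (ι ⊕ ι) ℝ →ₗ[ℝ] MvPolynomial (ι ⊕ ι) ℝ :=
  ∑ i, (pderiv (Sum.inl i)).toLinearMap ∘ₗ (pderiv (Sum.inr i)).toLinearMap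

lemma mixedLaplacian_apply (f : MvPolynomial (ι ⊕ ι) ℝ) :
    mixedLaplacian ι f = ∑ i, pderiv (Sum.inl i) (pderiv (Sum.inr i) f) := by
  simp [mixedLaplacian]

lemma mixedLaplacian_dotPoly_mul (f : MvPolynomial (ι ⊕ ι) ℝ) :
    mixedLaplacian ι (dotPoly ι * f) = dotPoly ι * mixedLaplacian ι f + Fintype.card ι * f
      + ∑ i, xVar i * pderiv (Sum.inl i) f + ∑ i, yVar i * pderiv (Sum.inr i) f := by
  simp only [mixedLaplacian_apply, Finset.mul_sum]
  have : (Fintype.card ι : MvPolynomial (ι ⊕ ι) ℝ) * f = ∑ i : ι, f := by simp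
  rw [this, ← Finset.sum_add_distrib, ← Finset.sum_add_distrib, ← Finset.sum_add_distrib]
  refine Finset.sum_congr rfl fun i _ => ?_
  simp only [Derivation.leibniz, pderiv_inr_dotPoly, map_add, pderiv_inl_dotPoly, smul_eq_mul,
    pderiv_X_self]
  ring

lemma mixedLaplacian_normSq_mul (f : MvPolynomial (ι ⊕ ι) ℝ) :
    mixedLaplacian ι (normSqX ι * normSqY ι * f)
      = normSqX ι * normSqY ι * mixedLaplacian ι f
        + 4 * dotPoly ι * f
        + 2 * normSqY ι * ∑ i, xVar i * pderiv (Sum.inr i) f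
        + 2 * normSqX ι * ∑ i, yVar i * pderiv (Sum.inl i) f := by
  simp only [mixedLaplacian_apply]
  conv_rhs => rw [dotPoly]
  simp only [Finset.mul_sum, Finset.sum_mul]
  rw [← Finset.sum_add_distrib, ← Finset.sum_add_distrib, ← Finset.sum_add_distrib]
  refine Finset.sum_congr rfl fun i _ => ?_
  classical
  have h2 (j : ι ⊕ ι) : pderiv j (2 : MvPolynomial (ι ⊕ ι) ℝ) = 0 := (pderiv j).map_natCast 2
  have hx : pderiv (Sum.inl i : ι ⊕ ι) (yVar i) = 0 := by
    simp [pderiv_X]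
  simp only [Derivation.leibniz, pderiv_inr_rename_normSqPoly, map_add, pderiv_inr_rename_inl,
    pderiv_inl_rename_inr, pderiv_inl_rename_normSqPoly, smul_eq_mul, h2, hx, mul_zero, add_zero,
    zero_add]
  ring

/-- The mixed Laplacian lowers the degree of the zonal polynomial by one. -/
lemma mixedLaplacian_zonal (hh : 2 ≤ Fintype.card ι) (l : ℕ) :
    mixedLaplacian ι (zonal ι l)
      = l * (Fintype.card ι + 2 * l - 2) * zonal ι (l - 1) := by
  induction l using Nat.twoStepInduction with
  | zero =>
    have h1 (j : ι ⊕ ι) : pderiv j (1 : MvPolynomial (ι ⊕ ι) ℝ) = 0 := (pderiv j).map_one_eq_zero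
    simp [zonal, gegHom, mixedLaplacian_apply, h1]
  | one =>
    simp [zonal, gegHom, mixedLaplacian_apply, pderiv_inr_dotPoly]
  | more l ih₀ ih₁ =>
    apply cancel_rec_coeff hh l
    set h := Fintype.card ι with hdef
    have r := congrArg (mixedLaplacian ι) (gegHom_rec hh (dotPoly ι)
      (normSqX ι * normSqY ι) l)
    have e₁ : (l + h - 1 : MvPolynomial (ι ⊕ ι) ℝ) = C (l + h - 1 : ℝ) := by simp
    have e₂ : (2 * l + h : MvPolynomial (ι ⊕ ι) ℝ) = C (2 * l + h : ℝ) := by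
      simp only [map_add, map_mul, map_natCast, map_ofNat]
    have e₃ : ((l : MvPolynomial (ι ⊕ ι) ℝ) + 1) = C (l + 1 : ℝ) := by simp
    have p := mul_gegHom_pred hh (dotPoly ι)
      (normSqX ι * normSqY ι) l
    -- view the coefficients as constants, to use linearity of the mixed Laplacian
    rw [map_sub, mul_assoc (_ + _), mul_assoc (_ + 1), e₁, e₂, e₃, C_mul', C_mul', C_mul',
      map_smul, map_smul, map_smul, ← C_mul', ← C_mul', ← C_mul', ← e₁, ← e₂, ← e₃] at r
    change _ * mixedLaplacian ι (zonal ι (l + 2))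
      = _ * mixedLaplacian ι (dotPoly ι * zonal ι (l + 1))
      - _ * mixedLaplacian ι (_ * zonal ι l) at r
    change _ * _ * zonal ι (l - 1) = _ * zonal ι l - _ * zonal ι (l + 1) at p
    rw [mixedLaplacian_dotPoly_mul, mixedLaplacian_normSq_mul, ih₀, ih₁,
      sum_inr_mul_pderiv_inl_zonal hh, sum_inl_mul_pderiv_inr_zonal hh,
      sum_inr_mul_pderiv_inr_zonal hh, sum_inl_mul_pderiv_inl_zonal hh] at r
    rw [r]
    simp only [Nat.add_sub_cancel, show l + 2 - 1 = l + 1 by omega, ← hdef]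
    push_cast
    linear_combination (-(l + 1) * (h + 2 * l + 2) : MvPolynomial (ι ⊕ ι) ℝ) * p

/-! ### Harmonic polynomials -/

/-- The Laplacian on polynomials. -/
def laplacian (f : MvPolynomial ι ℝ) : MvPolynomial ι ℝ := ∑ i, pderiv i (pderiv i f)

/-- Homogeneous harmonic polynomials of degree `l`. -/
def IsHarmonicHom (l : ℕ) (f : MvPolynomial ι ℝ) : Prop := f.IsHomogeneous l ∧ laplacian f = 0

lemma laplacian_normSqPoly_mul {k : ℕ} {g : MvPolynomial ι ℝ} (hg : g.IsHomogeneous k) :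
    laplacian (normSqPoly ι * g)
      = (2 * Fintype.card ι + 4 * k) * g + normSqPoly ι * laplacian g := by
  classical
  have h2 (j : ι) : pderiv j (2 : MvPolynomial ι ℝ) = 0 := (pderiv j).map_natCast 2
  have e : (2 * Fintype.card ι + 4 * k) * g = ∑ i : ι, (2 * g + 4 * (X i * pderiv i g)) := by
    rw [Finset.sum_add_distrib, ← Finset.mul_sum, ← Finset.mul_sum, hg.sum_X_mul_pderiv]
    simp
    ring
  rw [e, laplacian, laplacian, Finset.mul_sum, ← Finset.sum_add_distrib]
  refine Finset.sum_congr rfl fun i _ => ?_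
  simp only [Derivation.leibniz, pderiv_normSqPoly, map_add, smul_eq_mul, h2, pderiv_X_self]
  ring

/-- The raising operator `f ↦ xᵢ f - a ‖x‖² ∂f/∂xᵢ`. For `a = (card ι + 2 l - 2)⁻¹` it is
multiplication by `xᵢ` followed by the projection of homogeneous polynomials onto harmonic ones. -/
def raise (a : ℝ) (i : ι) (f : MvPolynomial ι ℝ) : MvPolynomial ι ℝ :=
  X i * f - C a * (normSqPoly ι * pderiv i f)

lemma normSqPoly_isHomogeneous : (normSqPoly ι).IsHomogeneous 2 :=
  IsHomogeneous.sum _ _ _ fun i _ => by simpa using (isHomogeneous_X ℝ i).pow 2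

lemma pderiv_comm {ι : Type*} (i j : ι) (f : MvPolynomial ι ℝ) :
    pderiv i (pderiv j f) = pderiv j (pderiv i f) := by
  classical
  have : ⁅pderiv (R := ℝ) i, pderiv (R := ℝ) j⁆ = 0 := by
    ext k
    simp [Derivation.commutator_apply, pderiv_X, Pi.single_apply, apply_ite,
      Derivation.map_one_eq_zero]
  simpa [Derivation.commutator_apply, sub_eq_zero] using congrArg (fun D => D f) this

/-- The value of `a` makes the term `2 ∂f/∂xᵢ` of the Laplacian of `xᵢ f` cancel. -/
lemma IsHarmonicHom.raise {l : ℕ} (hl : 1 ≤ l) {a : ℝ} (ha : a * (Fintype.card ι + 2 * l - 2) = 1)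
    {f : MvPolynomial ι ℝ} (hf : IsHarmonicHom l f) (i : ι) :
    IsHarmonicHom (l + 1) (raise a i f) := by
  classical
  have hd : (pderiv i f).IsHomogeneous (l - 1) := hf.1.pderiv
  constructor
  · apply IsHomogeneous.sub
    · simpa [add_comm] using (isHomogeneous_X ℝ i).mul hf.1
    · have := (isHomogeneous_C ι a).mul (normSqPoly_isHomogeneous.mul hd)
      rwa [show 0 + (2 + (l - 1)) = l + 1 by omega] at this
  · have h1 : laplacian (X i * f) = 2 * pderiv i f + X i * laplacian f := by
      have : pderiv i f = ∑ j, if j = i then pderiv j f else 0 := by simp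
      rw [this, laplacian, laplacian, Finset.mul_sum, Finset.mul_sum, ← Finset.sum_add_distrib]
      refine Finset.sum_congr rfl fun j _ => ?_
      by_cases hij : j = i
      · subst hij
        simp only [Derivation.leibniz, pderiv_X_self, map_add, smul_eq_mul, if_true,
          Derivation.map_one_eq_zero]
        ring
      · simp [Derivation.leibniz, pderiv_X_of_ne (Ne.symm hij), hij]
    have h2 : laplacian (pderiv i f) = pderiv i (laplacian f) := by
      rw [laplacian, laplacian, map_sum]
      refine Finset.sum_congr rfl fun j _ => ?_
      rw [pderiv_comm j i f, pderiv_comm j i]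
    have h3 : laplacian (X i * f - C a * (normSqPoly ι * pderiv i f))
        = laplacian (X i * f) - C a * laplacian (normSqPoly ι * pderiv i f) := by
      simp only [laplacian, map_sub, Derivation.leibniz, pderiv_C, mul_zero, add_zero,
        Finset.sum_sub_distrib, Finset.mul_sum, smul_eq_mul]
    have hc := congrArg (C (σ := ι)) ha
    simp only [C_mul, C_add, C_sub, map_one, map_natCast, map_ofNat] at hc
    rw [KPoint.raise, h3, h1, laplacian_normSqPoly_mul hd, h2, hf.2, Nat.cast_sub hl]
    simp only [map_zero, mul_zero, add_zero, Nat.cast_one]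
    linear_combination (-2 * pderiv i f) * hc

/-- The raising operators in both variables take the zonal polynomial of degree `l` to a positive
multiple of the one of degree `l + 1`. -/
lemma sum_raise_zonal (hh : 2 ≤ Fintype.card ι) (l : ℕ) {a : ℝ}
    (ha : a * (Fintype.card ι + 2 * l - 2) = 1) :
    ∑ i, (xVar i * (yVar i * zonal ι l
          - C a * (normSqY ι * pderiv (Sum.inr i) (zonal ι l)))
        - C a * (normSqX ι * pderiv (Sum.inl i) (yVar i * zonal ι l
          - C a * (normSqY ι * pderiv (Sum.inr i) (zonal ι l)))))
      = C (a * (l + Fintype.card ι - 2)) * zonal ι (l + 1) := by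
  classical
  have expand (i : ι) : xVar i * (yVar i * zonal ι l
          - C a * (normSqY ι * pderiv (Sum.inr i) (zonal ι l)))
        - C a * (normSqX ι * pderiv (Sum.inl i) (yVar i * zonal ι l
          - C a * (normSqY ι * pderiv (Sum.inr i) (zonal ι l))))
      = xVar i * yVar i * zonal ι l
        - C a * normSqY ι * (xVar i * pderiv (Sum.inr i) (zonal ι l))
        - C a * normSqX ι * (yVar i * pderiv (Sum.inl i) (zonal ι l))
        + C a ^ 2 * normSqX ι * normSqY ι
          * pderiv (Sum.inl i) (pderiv (Sum.inr i) (zonal ι l)) := by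
    have hx : pderiv (Sum.inl i : ι ⊕ ι) (yVar i) = 0 := by
      simp [pderiv_X]
    simp only [map_sub, Derivation.leibniz, pderiv_C, add_zero, smul_eq_mul,
      pderiv_inl_rename_inr, hx, mul_zero]
    ring
  simp only [expand, Finset.sum_add_distrib, Finset.sum_sub_distrib, ← Finset.mul_sum,
    ← Finset.sum_mul]
  rw [sum_inr_mul_pderiv_inl_zonal hh, sum_inl_mul_pderiv_inr_zonal hh, ← mixedLaplacian_apply,
    mixedLaplacian_zonal hh]
  have p := mul_gegHom_pred hh (dotPoly ι)
      (normSqX ι * normSqY ι) l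
  have hc := congrArg (C (σ := ι ⊕ ι)) ha
  simp only [C_mul, C_add, C_sub, map_one, map_natCast, map_ofNat] at hc ⊢
  change _ * _ * zonal ι (l - 1) = _ * zonal ι l - _ * zonal ι (l + 1) at p
  change dotPoly ι * _ - _ - _ + _ = _
  generalize zonal ι (l - 1) = z₀ at *
  generalize zonal ι (l + 1) = z₁ at *
  linear_combination (-C a) * p
    + (C a * l * normSqX ι * normSqY ι * z₀
        - dotPoly ι * zonal ι l) * hc

/-- **Positive definiteness of the zonal polynomial.** It is a nonnegative combination of
`f(x) f(y)` with `f` harmonic and homogeneous of degree `l`. -/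
lemma zonal_eq_sum (ι : Type) [Fintype ι] (l : ℕ) (h : l ≤ 1 ∨ 2 ≤ Fintype.card ι) :
    ∃ (κ : Type) (_ : Fintype κ) (f : κ → MvPolynomial ι ℝ) (c : ℝ), 0 ≤ c ∧
      (∀ m, IsHarmonicHom l (f m)) ∧
      zonal ι l = C c * ∑ m, rename Sum.inl (f m) * rename Sum.inr (f m) := by
  classical
  have h1 (j : ι) : pderiv j (1 : MvPolynomial ι ℝ) = 0 := (pderiv j).map_one_eq_zero
  have one : ∃ (κ : Type) (_ : Fintype κ) (f : κ → MvPolynomial ι ℝ) (c : ℝ), 0 ≤ c ∧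
      (∀ m, IsHarmonicHom 1 (f m)) ∧
      zonal ι 1 = C c * ∑ m, rename Sum.inl (f m) * rename Sum.inr (f m) := by
    refine ⟨ι, inferInstance, X, 1, zero_le_one, fun m => ⟨isHomogeneous_X _ _, ?_⟩, ?_⟩
    · simp [laplacian, pderiv_X, Pi.single_apply, apply_ite, h1]
    · simp [zonal, gegHom, dotPoly]
  rcases Nat.eq_zero_or_pos l with rfl | hl
  · refine ⟨Unit, inferInstance, fun _ => 1, 1, zero_le_one,
      fun _ => ⟨isHomogeneous_one _ _, ?_⟩, ?_⟩
    · simp [laplacian, h1]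
    · simp [zonal, gegHom]
  rcases h with h | hh
  · obtain rfl : l = 1 := by omega
    exact one
  induction l, hl using Nat.le_induction with
  | base => exact one
  | succ l hl ih =>
    obtain ⟨κ, _, f, c, hc, hf, hz⟩ := ih
    have h2 : (2 : ℝ) ≤ Fintype.card ι := by exact_mod_cast hh
    have l1 : (1 : ℝ) ≤ l := by exact_mod_cast hl
    set b : ℝ := Fintype.card ι + 2 * l - 2 with hb
    have hb0 : 0 < b := by linarith
    have ha : b⁻¹ * (Fintype.card ι + 2 * l - 2) = 1 := inv_mul_cancel₀ hb0.ne'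
    have hpos : 0 < b⁻¹ * (l + Fintype.card ι - 2) := mul_pos (inv_pos.2 hb0) (by linarith)
    refine ⟨ι × κ, inferInstance, fun m => raise b⁻¹ m.1 (f m.2),
      c * (b⁻¹ * (l + Fintype.card ι - 2))⁻¹, by positivity,
      fun m => (hf m.2).raise hl ha m.1, ?_⟩
    have key := sum_raise_zonal hh l ha
    have hk : C (b⁻¹ * (l + Fintype.card ι - 2))⁻¹ * C (b⁻¹ * (l + Fintype.card ι - 2))
        = (1 : MvPolynomial (ι ⊕ ι) ℝ) := by
      rw [← C_mul, inv_mul_cancel₀ hpos.ne', C_1]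
    rw [← one_mul (zonal ι (l + 1)), ← hk, mul_assoc, ← key, C_mul, mul_comm (C c), mul_assoc]
    congr 1
    rw [Fintype.sum_prod_type, Finset.mul_sum]
    refine Finset.sum_congr rfl fun i _ => ?_
    have hx : pderiv (Sum.inl i : ι ⊕ ι) (yVar i) = 0 := by
      simp [pderiv_X]
    rw [hz]
    simp only [raise, map_sub, map_mul, rename_X, rename_C, Derivation.leibniz, pderiv_C,
      map_sum, pderiv_inl_rename_inr, pderiv_inr_rename_inl, pderiv_rename Sum.inl_injective,
      pderiv_rename Sum.inr_injective, hx, smul_eq_mul, mul_zero, add_zero, zero_add,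
      Finset.mul_sum, ← Finset.sum_sub_distrib]
    refine Finset.sum_congr rfl fun m _ => ?_
    ring

end Zonal

/-! ### Harmonic polynomials constant on the sphere -/

section HarmonicVanishing

lemma IsHarmonicHom.sum_C_mul {ι κ : Type*} [Fintype ι] [Fintype κ] {l : ℕ}
    {f : κ → MvPolynomial ι ℝ} (hf : ∀ m, IsHarmonicHom l (f m)) (a : κ → ℝ) :
    IsHarmonicHom l (∑ m, C (a m) * f m) := by
  constructor
  · exact IsHomogeneous.sum _ _ _ fun m _ => by
      simpa using (isHomogeneous_C ι (a m)).mul (hf m).1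
  · have (i : ι) : pderiv i (pderiv i (∑ m, C (a m) * f m))
        = ∑ m, C (a m) * pderiv i (pderiv i (f m)) := by
      simp only [map_sum, pderiv_C_mul]
    rw [laplacian]
    simp only [this]
    rw [Finset.sum_comm]
    refine Finset.sum_eq_zero fun m _ => ?_
    rw [← Finset.mul_sum]
    have := (hf m).2
    rw [laplacian] at this
    rw [this, mul_zero]

lemma eval_smul_of_isHomogeneous {ι : Type*} {l : ℕ} {p : MvPolynomial ι ℝ}
    (hp : p.IsHomogeneous l) (a : ℝ) (x : ι → ℝ) :
    eval (fun i => a * x i) p = a ^ l * eval x p := by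
  rw [eval_eq, eval_eq, Finset.mul_sum]
  refine Finset.sum_congr rfl fun m hm => ?_
  have : ∑ i ∈ m.support, m i = l := by
    simpa [Finsupp.weight_apply, Finsupp.sum] using hp (mem_support_iff.1 hm)
  simp only [mul_pow, Finset.prod_mul_distrib]
  rw [Finset.prod_pow_eq_pow_sum, this]
  ring

variable {ι : Type*} [Fintype ι]

lemma laplacian_normSqPoly_pow (m : ℕ) :
    laplacian (normSqPoly ι ^ (m + 1))
      = (m + 1) * (2 * Fintype.card ι + 4 * m) * normSqPoly ι ^ m := by
  induction m with
  | zero =>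
    have h1 := laplacian_normSqPoly_mul (isHomogeneous_one ι ℝ)
    simpa [laplacian, pderiv_one] using h1
  | succ m ih =>
    have hg : (normSqPoly ι ^ (m + 1)).IsHomogeneous (2 * (m + 1)) :=
      normSqPoly_isHomogeneous.pow _
    rw [pow_succ' _ (m + 1), laplacian_normSqPoly_mul hg, ih]
    push_cast
    ring

/-- A harmonic homogeneous polynomial of positive degree which is constant on the unit sphere
vanishes: it is odd or a multiple of a power of the squared norm, and the latter is not
harmonic. -/
lemma IsHarmonicHom.eq_zero_of_sphere [Nonempty ι] {l : ℕ} (hl : 1 ≤ l) {q : MvPolynomial ι ℝ}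
    (hq : IsHarmonicHom l q) {c : ℝ} (hc : ∀ x : ι → ℝ, ∑ i, x i ^ 2 = 1 → eval x q = c) :
    q = 0 := by
  classical
  obtain ⟨j⟩ := ‹Nonempty ι›
  have hunit : ∑ i, (Pi.single j 1 : ι → ℝ) i ^ 2 = 1 := by
    simp [Pi.single_apply]
  have hval (x : ι → ℝ) : eval x q = c * √(∑ i, x i ^ 2) ^ l := by
    have h0 : 0 ≤ ∑ i, x i ^ 2 := Finset.sum_nonneg fun i _ => sq_nonneg _
    set r := √(∑ i, x i ^ 2) with hr
    have hr2 : r ^ 2 = ∑ i, x i ^ 2 := Real.sq_sqrt h0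
    rcases eq_or_ne r 0 with h | h
    · have hx : x = fun i => (0 : ℝ) * x i := by
        rw [h] at hr2
        funext i
        have := (Finset.sum_eq_zero_iff_of_nonneg (fun i _ => sq_nonneg (x i))).1
          (hr2.symm.trans (by simp)) i (Finset.mem_univ i)
        simpa using this
      rw [hx, eval_smul_of_isHomogeneous hq.1, h, zero_pow (by omega)]
      simp
    · have hx : x = fun i => r * (r⁻¹ * x i) := by
        funext i
        rw [mul_inv_cancel_left₀ h]
      conv_lhs => rw [hx]
      rw [eval_smul_of_isHomogeneous hq.1, hc, mul_comm]
      simp only [mul_pow]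
      rw [← Finset.mul_sum, ← hr2]
      field_simp
  suffices c = 0 by
    apply MvPolynomial.funext
    intro x
    simp [hval, this]
  rcases Nat.even_or_odd l with h | h
  · obtain ⟨m, rfl⟩ : ∃ m, l = 2 * (m + 1) := by
      obtain ⟨k, rfl⟩ := h
      exact ⟨k - 1, by omega⟩
    have hqe : q = C c * normSqPoly ι ^ (m + 1) := by
      apply MvPolynomial.funext
      intro x
      rw [hval, pow_mul, Real.sq_sqrt (Finset.sum_nonneg fun i _ => sq_nonneg _)]
      simp [normSqPoly]
    have hΔ := hq.2
    have hC : laplacian (C c * normSqPoly ι ^ (m + 1))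
        = C c * laplacian (normSqPoly ι ^ (m + 1)) := by
      simp only [laplacian, pderiv_C_mul, Finset.mul_sum]
    rw [hqe, hC, laplacian_normSqPoly_pow] at hΔ
    have hev := congrArg (eval (Pi.single j 1 : ι → ℝ)) hΔ
    have hn : eval (Pi.single j 1 : ι → ℝ) (normSqPoly ι) = 1 := by
      simp [normSqPoly, Pi.single_apply]
    simp only [map_mul, eval_C, map_pow, hn, one_pow, mul_one, map_add, map_natCast, map_one,
      map_ofNat, map_zero] at hev
    have hpos : (0 : ℝ) < Fintype.card ι := by
      have : 0 < Fintype.card ι := Fintype.card_pos_iff.2 ⟨j⟩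
      exact_mod_cast this
    refine (mul_eq_zero.1 hev).resolve_right ?_
    positivity
  · have h1 := hc _ hunit
    have h2 := hc (fun i => (-1) * (Pi.single j 1 : ι → ℝ) i) (by simpa using hunit)
    rw [eval_smul_of_isHomogeneous hq.1, h.neg_one_pow, h1] at h2
    linarith

end HarmonicVanishing

/-! ### Invariance of the surface measure -/

section Sphere

variable {d : ℕ}

/-- The action of a linear isometry on the unit sphere. -/
def sphMap (U : Euc d ≃ₗᵢ[ℝ] Euc d) (x : Sph d) : Sph d := ⟨U x, by simp⟩

lemma measurableEmbedding_sphMap (U : Euc d ≃ₗᵢ[ℝ] Euc d) : MeasurableEmbedding (sphMap U) := by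
  have hc : Continuous (sphMap U) := by unfold sphMap; fun_prop
  refine hc.measurableEmbedding fun x y h => ?_
  have := congrArg (Subtype.val) h
  exact Subtype.ext (U.injective this)

open scoped Pointwise in
lemma measurePreserving_sphMap_sigma (U : Euc d ≃ₗᵢ[ℝ] Euc d) :
    MeasurePreserving (sphMap U) (sigma d) (sigma d) := by
  refine MeasurePreserving.smul_measure ⟨(measurableEmbedding_sphMap U).measurable, ?_⟩ _
  ext s hs
  rw [Measure.map_apply (measurableEmbedding_sphMap U).measurable hs,
    Measure.toSphere_apply' _ hs,
    Measure.toSphere_apply' _ ((measurableEmbedding_sphMap U).measurable hs)]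
  congr 1
  rw [← U.measurePreserving.measure_preimage_emb U.toHomeomorph.measurableEmbedding
    (Set.Ioo (0 : ℝ) 1 • (Subtype.val '' s))]
  congr 1
  ext x
  simp only [Set.mem_smul, Set.mem_image, Set.mem_preimage]
  constructor
  · rintro ⟨r, hr, _, ⟨y, hy, rfl⟩, rfl⟩
    exact ⟨r, hr, _, ⟨_, hy, rfl⟩, by simp [sphMap]⟩
  · rintro ⟨r, hr, _, ⟨y, hy, rfl⟩, h⟩
    refine ⟨r, hr, _, ⟨sphMap U.symm y, ?_, rfl⟩, ?_⟩
    · convert hy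
      ext1
      simp [sphMap]
    · apply U.injective
      simp [sphMap, h]

lemma isProbabilityMeasure_sigma (hd : 1 ≤ d) : IsProbabilityMeasure (sigma d) := by
  have : Nontrivial (Euc d) := by
    have : Nonempty (Fin d) := ⟨⟨0, hd⟩⟩
    infer_instance
  constructor
  rw [sigma, Measure.smul_apply, smul_eq_mul]
  refine ENNReal.inv_mul_cancel ?_ (measure_ne_top _ _)
  rw [Ne, Measure.measure_univ_eq_zero]
  exact Measure.toSphere_ne_zero _

/-- Integrals over the sphere of functions of `⟨E, x⟩` and of the norm of the projection of `x` to
`V` are the same for all `E ∈ V` of the same norm: use the reflection that exchanges two such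
vectors, which preserves `V`. -/
lemma integral_sigma_eq_of_norm_eq (V : Submodule ℝ (Euc d)) {E F : Euc d} (hE : E ∈ V)
    (hF : F ∈ V) (h : ‖E‖ = ‖F‖) (Φ : ℝ → ℝ → ℝ) :
    ∫ x : Sph d, Φ (inner ℝ E (x : Euc d)) (‖V.starProjection x‖ ^ 2) ∂sigma d
      = ∫ x : Sph d, Φ (inner ℝ F (x : Euc d)) (‖V.starProjection x‖ ^ 2) ∂sigma d := by
  set U := (ℝ ∙ (E - F))ᗮ.reflection with hU
  have hUE : U E = F := Submodule.reflection_sub h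
  rw [← (measurePreserving_sphMap_sigma U).integral_comp (measurableEmbedding_sphMap U)
    (fun x => Φ (inner ℝ F (x : Euc d)) (‖V.starProjection x‖ ^ 2))]
  congr 1
  funext x
  have h1 : inner ℝ F (sphMap U x : Euc d) = inner ℝ E (x : Euc d) := by
    rw [← hUE]
    exact U.inner_map_map _ _
  have hmem : U (x : Euc d) - x ∈ V := by
    have hle : (ℝ ∙ (E - F)) ≤ V := by
      rw [Submodule.span_singleton_le_iff_mem]
      exact V.sub_mem hE hF
    apply hle
    rw [← Submodule.orthogonal_orthogonal (ℝ ∙ (E - F)), hU, Submodule.reflection_apply]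
    have := Submodule.sub_starProjection_mem_orthogonal (K := (ℝ ∙ (E - F))ᗮ) (x : Euc d)
    have e : (2 • (ℝ ∙ (E - F))ᗮ.starProjection (x : Euc d) - (x : Euc d)) - x
        = (-2 : ℝ) • ((x : Euc d) - (ℝ ∙ (E - F))ᗮ.starProjection (x : Euc d)) := by
      module
    rw [e]
    exact Submodule.smul_mem _ _ this
  have h2 : ‖V.starProjection (sphMap U x : Euc d)‖ ^ 2 = ‖V.starProjection (x : Euc d)‖ ^ 2 := by
    have hp : Vᗮ.starProjection (U (x : Euc d)) = Vᗮ.starProjection (x : Euc d) := by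
      rw [← sub_eq_zero, ← map_sub, Submodule.starProjection_apply_eq_zero_iff,
        Submodule.orthogonal_orthogonal]
      exact hmem
    have e1 := V.norm_sq_eq_add_norm_sq_starProjection (x : Euc d)
    have e2 := V.norm_sq_eq_add_norm_sq_starProjection (U (x : Euc d))
    rw [hp, U.norm_map] at e2
    change ‖V.starProjection (U (x : Euc d))‖ ^ 2 = _
    linarith
  rw [h1, h2]

end Sphere

/-! ### Zonal averages over the sphere -/

section Average

variable {d : ℕ}

instance isFiniteMeasure_sigma : IsFiniteMeasure (sigma d) := by
  rcases Nat.eq_zero_or_pos d with rfl | hd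
  · have : IsEmpty (Sph 0) := ⟨fun x => by
      have h := x.2
      rw [mem_sphere_zero_iff_norm, Subsingleton.elim (x : Euc 0) 0] at h
      simp at h⟩
    rw [Measure.eq_zero_of_isEmpty (sigma 0)]
    infer_instance
  · have := isProbabilityMeasure_sigma hd
    infer_instance

/-- The coordinates of the projection of `x` to `V` in an orthonormal basis of `V`. -/
def projCoord {ι : Type*} [Fintype ι] {V : Submodule ℝ (Euc d)} (b : OrthonormalBasis ι ℝ V)
    (x : Euc d) : ι → ℝ := fun i => b.repr (V.orthogonalProjectionOnto x) i

variable {ι : Type*} [Fintype ι] {V : Submodule ℝ (Euc d)} (b : OrthonormalBasis ι ℝ V)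

lemma continuous_projCoord (i : ι) : Continuous fun x : Sph d => projCoord b x i := by
  have : Continuous fun x : Sph d => b.repr (V.orthogonalProjectionOnto (x : Euc d)) := by
    fun_prop
  unfold projCoord
  fun_prop

lemma continuous_eval_projCoord (p : MvPolynomial ι ℝ) :
    Continuous fun x : Sph d => eval (projCoord b x) p := by
  apply p.continuous_eval.comp
  exact continuous_pi fun i => continuous_projCoord b i

lemma sum_projCoord_mul (x y : Euc d) :
    ∑ i, projCoord b x i * projCoord b y i
      = inner ℝ (V.starProjection x) (V.starProjection y) := by
  have := b.repr.inner_map_map (V.orthogonalProjectionOnto x) (V.orthogonalProjectionOnto y)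
  rw [PiLp.inner_apply] at this
  simp only [Submodule.starProjection_apply, ← Submodule.coe_inner, ← this]
  exact Finset.sum_congr rfl fun i _ => by simp [projCoord, mul_comm]

lemma sum_projCoord_sq (x : Euc d) : ∑ i, projCoord b x i ^ 2 = ‖V.starProjection x‖ ^ 2 := by
  simp only [sq, sum_projCoord_mul, real_inner_self_eq_norm_mul_norm]

lemma exists_mem_projCoord (e : ι → ℝ) : ∃ E ∈ V, projCoord b E = e := by
  refine ⟨b.repr.symm (WithLp.toLp 2 e), Submodule.coe_mem _, ?_⟩
  funext i
  simp [projCoord]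

lemma eval_zonal (l : ℕ) (x y : ι → ℝ) :
    eval (Sum.elim x y) (zonal ι l)
      = gegHom (Fintype.card ι) (∑ i, x i * y i) ((∑ i, x i ^ 2) * ∑ i, y i ^ 2) l := by
  rw [zonal, ← coe_aeval_eq_eval, RingHom.coe_coe, map_gegHom]
  simp [dotPoly, normSqX, normSqY, normSqPoly]

lemma eval_zonal_projCoord (l : ℕ) (x y : Euc d) :
    eval (Sum.elim (projCoord b x) (projCoord b y)) (zonal ι l)
      = gegHom (Fintype.card ι) (inner ℝ (V.starProjection x) (V.starProjection y))
          (‖V.starProjection x‖ ^ 2 * ‖V.starProjection y‖ ^ 2) l := by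
  simp only [eval_zonal, sum_projCoord_mul, sum_projCoord_sq]

lemma integrable_eval_projCoord (μ : Measure (Sph d)) [IsFiniteMeasure μ] (p : MvPolynomial ι ℝ) :
    Integrable (fun x : Sph d => eval (projCoord b x) p) μ :=
  (continuous_eval_projCoord b p).integrable_of_hasCompactSupport
    (HasCompactSupport.of_compactSpace _)

/-- The mean of the zonal polynomial over the sphere, as a function of its pole, is harmonic and
constant on the unit sphere of `V`, hence zero. -/
lemma integral_zonal_eq_zero {ι : Type} [Fintype ι] [Nonempty ι] {V : Submodule ℝ (Euc d)}
    (b : OrthonormalBasis ι ℝ V) {l : ℕ} (hl : 1 ≤ l) (h : l ≤ 1 ∨ 2 ≤ Fintype.card ι)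
    (e : ι → ℝ) :
    ∫ x : Sph d, eval (Sum.elim e (projCoord b x)) (zonal ι l) ∂sigma d = 0 := by
  obtain ⟨κ, _, f, c, -, hf, hz⟩ := zonal_eq_sum ι l h
  set q : MvPolynomial ι ℝ :=
    ∑ m, C (c * ∫ x : Sph d, eval (projCoord b x) (f m) ∂sigma d) * f m with hq
  have hqe (e : ι → ℝ) : ∫ x : Sph d, eval (Sum.elim e (projCoord b x)) (zonal ι l) ∂sigma d
      = eval e q := by
    have (x : Sph d) : eval (Sum.elim e (projCoord b x)) (zonal ι l)
        = ∑ m, c * eval e (f m) * eval (projCoord b x) (f m) := by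
      simp only [hz, map_mul, map_sum, eval_C, eval_rename, Sum.elim_comp_inl, Sum.elim_comp_inr,
        Finset.mul_sum, mul_assoc]
    simp only [this]
    rw [integral_finsetSum _ fun m _ => (integrable_eval_projCoord b _ (f m)).const_mul _, hq,
      map_sum]
    refine Finset.sum_congr rfl fun m _ => ?_
    rw [integral_const_mul, map_mul, eval_C]
    ring
  have hharm : IsHarmonicHom l q := IsHarmonicHom.sum_C_mul hf _
  classical
  obtain ⟨j⟩ := ‹Nonempty ι›
  have : Nonempty ι := ⟨j⟩
  suffices hq0 : q = 0 by rw [hqe, hq0, map_zero]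
  refine hharm.eq_zero_of_sphere hl (c := eval (Pi.single j 1) q) fun e he => ?_
  rw [← hqe, ← hqe]
  obtain ⟨E, hE, rfl⟩ := exists_mem_projCoord b e
  obtain ⟨F, hF, hFj⟩ := exists_mem_projCoord b (Pi.single j 1)
  have hF1 : ∑ i, projCoord b F i ^ 2 = 1 := by
    simp [hFj, Pi.single_apply]
  rw [← hFj]
  simp only [sum_projCoord_sq,
    Submodule.starProjection_eq_self_iff.2 hE, Submodule.starProjection_eq_self_iff.2 hF,
    eval_zonal_projCoord] at he hF1 ⊢
  have hin {G : Euc d} (hG : G ∈ V) (x : Euc d) :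
      inner ℝ G (V.starProjection x) = inner ℝ G x := by
    rw [← Submodule.inner_starProjection_left_eq_right,
      Submodule.starProjection_eq_self_iff.2 hG]
  have hEF : ‖E‖ = ‖F‖ := by
    rw [← sq_eq_sq₀ (norm_nonneg _) (norm_nonneg _), he, hF1]
  simp only [hin hE, hin hF, he, hF1, one_mul]
  exact integral_sigma_eq_of_norm_eq V hE hF hEF fun s w => gegHom (Fintype.card ι) s w l

end Average

/-! ### The kernel in terms of Gram determinants -/

section Gram

variable {d n : ℕ}

lemma Q_eq_gegHom (l : ℕ) (x : Fin (n + 2) → Sph d) :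
    Q d n l x = (Matrix.gram ℝ (lastInputs x)).det ^ l
      * gegHom (d - n) (inner ℝ (perp x (x 0)) (perp x (x 1)))
          (‖perp x (x 0)‖ ^ 2 * ‖perp x (x 1)‖ ^ 2) l := by
  set a := perp x (x 0)
  set b := perp x (x 1)
  have hinner : ‖a‖ * ‖b‖ * inner ℝ ((‖a‖⁻¹ : ℝ) • a) ((‖b‖⁻¹ : ℝ) • b) = inner ℝ a b := by
    rw [real_inner_smul_left, real_inner_smul_right]
    rcases eq_or_ne a 0 with ha | ha
    · simp [ha]
    rcases eq_or_ne b 0 with hb | hb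
    · simp [hb]
    have := norm_ne_zero_iff.2 ha
    have := norm_ne_zero_iff.2 hb
    field_simp
  rw [← hinner, ← mul_pow, ← pow_mul_gegenbauer_eval, Q]
  ring

/-- The Gram matrix of `x_3, …, x_k` bordered by `u` (row) and `v` (column). -/
def borderedGram (x : Fin (n + 2) → Sph d) (u v : Euc d) :
    Matrix (Unit ⊕ Fin n) (Unit ⊕ Fin n) ℝ :=
  Matrix.of fun i j => inner ℝ (Sum.elim (fun _ => u) (lastInputs x) i)
    (Sum.elim (fun _ => v) (lastInputs x) j)

/-- Column operations replace the bordering column `v` by its orthogonal projection. This needs no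
linear independence of `x_3, …, x_k`. -/
lemma det_borderedGram (x : Fin (n + 2) → Sph d) (u v : Euc d) :
    (borderedGram x u v).det
      = (Matrix.gram ℝ (lastInputs x)).det * inner ℝ (perp x u) (perp x v) := by
  set S := Submodule.span ℝ (Set.range (lastInputs x)) with hS
  have hmem : v - perp x v ∈ S := by
    have := Submodule.sub_starProjection_mem_orthogonal (K := Sᗮ) v
    rwa [Submodule.orthogonal_orthogonal] at this
  obtain ⟨c, hc⟩ := (Submodule.mem_span_range_iff_exists_fun ℝ).1 hmem
  have hv : v = perp x v + ∑ i, c i • lastInputs x i := by rw [hc]; abel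
  have hperp (i : Fin n) : inner ℝ (lastInputs x i) (perp x v) = (0 : ℝ) := by
    have h1 : perp x v ∈ Sᗮ := Submodule.starProjection_apply_mem _ _
    exact (Submodule.mem_orthogonal _ _).1 h1 _ (Submodule.subset_span ⟨i, rfl⟩)
  have hu : inner ℝ u (perp x v) = (inner ℝ (perp x u) (perp x v) : ℝ) := by
    change inner ℝ u (Sᗮ.starProjection v)
      = (inner ℝ (Sᗮ.starProjection u) (Sᗮ.starProjection v) : ℝ)
    rw [Submodule.inner_starProjection_left_eq_right, Submodule.starProjection_eq_self_iff.2
      (Submodule.starProjection_apply_mem _ _)]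
  -- the bordered matrix is a block triangular one times a unipotent one
  have hfac : borderedGram x u v
      = Matrix.fromBlocks (Matrix.of fun _ _ : Unit => inner ℝ (perp x u) (perp x v))
          (Matrix.of fun _ j => inner ℝ u (lastInputs x j)) 0 (Matrix.gram ℝ (lastInputs x))
        * Matrix.fromBlocks 1 0 (Matrix.of fun i _ => c i) 1 := by
    rw [Matrix.fromBlocks_multiply]
    ext i j
    rcases i with i | i <;> rcases j with j | j
    · simp only [borderedGram, Matrix.of_apply, Sum.elim_inl]
      conv_lhs => rw [hv]
      simp [inner_add_right, inner_sum, inner_smul_right, hu, Matrix.mul_apply, mul_comm]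
    · simp [borderedGram]
    · simp only [borderedGram, Matrix.of_apply, Sum.elim_inl, Sum.elim_inr]
      conv_lhs => rw [hv]
      simp [inner_add_right, inner_sum, inner_smul_right, hperp, Matrix.mul_apply, mul_comm]
    · simp [borderedGram]
  rw [hfac, Matrix.det_mul, Matrix.det_fromBlocks_zero₂₁, Matrix.det_fromBlocks_zero₁₂]
  simp [mul_comm]

/-- The matrix of variables whose determinant gives the bordered Gram determinant with borders
`x_i` and `x_j`. -/
def borderedVars (n : ℕ) (i j : Fin (n + 2)) :
    Matrix (Unit ⊕ Fin n) (Unit ⊕ Fin n) (MvPolynomial (Fin (n + 2) × Fin (n + 2)) ℝ) :=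
  Matrix.of fun a b => X (Sum.elim (fun _ => i) (fun m => m.succ.succ) a,
    Sum.elim (fun _ => j) (fun m => m.succ.succ) b)

lemma eval_det_borderedVars (x : Fin (n + 2) → Sph d) (i j : Fin (n + 2)) :
    eval (fun ij => inner ℝ (x ij.1 : Euc d) (x ij.2 : Euc d)) (borderedVars n i j).det
      = (Matrix.gram ℝ (lastInputs x)).det * inner ℝ (perp x (x i)) (perp x (x j)) := by
  rw [← det_borderedGram, RingHom.map_det]
  congr 1
  ext a b
  rcases a with a | a <;> rcases b with b | b <;>
    simp [borderedVars, borderedGram, lastInputs]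

lemma isPolynomialKernel_Q (d n l : ℕ) : IsPolynomialKernel (Q d n l) := by
  refine ⟨gegHom (d - n) (borderedVars n 0 1).det
    ((borderedVars n 0 0).det * (borderedVars n 1 1).det) l, fun x => ?_⟩
  rw [Q_eq_gegHom, pow_mul_gegHom, ← coe_aeval_eq_eval, RingHom.coe_coe, map_gegHom, map_mul]
  simp only [← RingHom.coe_coe (aeval (R := ℝ) _), coe_aeval_eq_eval, eval_det_borderedVars,
    real_inner_self_eq_norm_sq]
  congr 1
  ring

lemma IsPolynomialKernel.continuous {k : ℕ} {K : (Fin k → Sph d) → ℝ} (h : IsPolynomialKernel K) :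
    Continuous K := by
  obtain ⟨p, hp⟩ := h
  rw [funext hp]
  exact p.continuous_eval.comp (by fun_prop)

lemma IsPolynomialKernel.isRotationInvariant {k : ℕ} {K : (Fin k → Sph d) → ℝ}
    (h : IsPolynomialKernel K) : IsRotationInvariant K := by
  obtain ⟨p, hp⟩ := h
  intro U x x' hx
  simp only [hp, hx, U.inner_map_map]

end Gram

/-! ### Positive definiteness -/

section Positive

/-- Signed measures have finite variation, since the variation is at most the sum of the two parts
of the Jordan decomposition. So continuous functions on compact spaces are integrable against
them, and `signedIntegral` takes no junk values there. -/
lemma isFiniteMeasure_variation {X : Type*} [MeasurableSpace X] (ν : SignedMeasure X) :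
    IsFiniteMeasure ν.variation := by
  refine isFiniteMeasure_of_le ν.totalVariation ?_
  apply VectorMeasure.variation_le_of_forall_enorm_le
  intro s hs
  conv_lhs => rw [← ν.toSignedMeasure_toJordanDecomposition]
  rw [JordanDecomposition.toSignedMeasure, _root_.sub_apply,
    Measure.toSignedMeasure_apply_measurable hs, Measure.toSignedMeasure_apply_measurable hs,
    SignedMeasure.totalVariation, Measure.add_apply]
  refine (enorm_sub_le).trans (add_le_add ?_ ?_) <;>
  · rw [Real.enorm_eq_ofReal measureReal_nonneg, ofReal_measureReal]

lemma integrable_variation_of_continuous {X : Type*} [MeasurableSpace X] [TopologicalSpace X]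
    [CompactSpace X] [OpensMeasurableSpace X] (ν : SignedMeasure X) {f : X → ℝ}
    (hf : Continuous f) : ν.Integrable f := by
  have := isFiniteMeasure_variation ν
  exact hf.integrable_of_hasCompactSupport (HasCompactSupport.of_compactSpace _)

lemma signedIntegral_sum_mul {X κ : Type*} [Fintype κ] [MeasurableSpace X] [TopologicalSpace X]
    [CompactSpace X] [OpensMeasurableSpace X] (ν : SignedMeasure X) {g : κ → X → ℝ}
    (hg : ∀ m, Continuous (g m)) (a : κ → ℝ) :
    signedIntegral ν (fun x => ∑ m, a m * g m x) = ∑ m, a m * signedIntegral ν (g m) := by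
  have h := VectorMeasure.integral_finsetSum (μ := ν) (B := (ContinuousLinearMap.lsmul ℝ ℝ).flip)
    Finset.univ (f := fun m x => a m • g m x)
    (fun m _ => integrable_variation_of_continuous ν ((hg m).const_smul (a m)))
  refine h.trans (Finset.sum_congr rfl fun m _ => ?_)
  exact VectorMeasure.integral_fun_smul _ _ (a m) (g m)

variable {d n : ℕ}

/-- A two-input kernel that is a nonnegative multiple of `∑ g(x) g(y)` is positive definite. -/
lemma isPositiveDefinite_of_eq_sum {κ : Type*} [Fintype κ] {K : Sph d → Sph d → ℝ} {c : ℝ}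
    (hc : 0 ≤ c) {g : κ → Sph d → ℝ} (hg : ∀ m, Continuous (g m))
    (hK : ∀ x y, K x y = c * ∑ m, g m x * g m y) : IsPositiveDefinite K := by
  refine ⟨fun x y => by simp only [hK, mul_comm], fun ν => ?_⟩
  have h1 (y : Sph d) : signedIntegral ν (fun x => K x y)
      = ∑ m, (c * signedIntegral ν (g m)) * g m y := by
    have : (fun x => K x y) = fun x => ∑ m, (c * g m y) * g m x := by
      funext x
      rw [hK, Finset.mul_sum]
      exact Finset.sum_congr rfl fun m _ => by ring
    rw [this, signedIntegral_sum_mul ν hg]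
    exact Finset.sum_congr rfl fun m _ => by ring
  simp only [h1]
  rw [signedIntegral_sum_mul ν hg]
  refine Finset.sum_nonneg fun m _ => ?_
  rw [mul_assoc]
  exact mul_nonneg hc (mul_self_nonneg _)

/-- If the orthogonal complement of the last inputs has dimension `d - n`, then `Q` is the zonal
polynomial of the coordinates of `x_1, x_2` in that complement, scaled by `det(W)^l`. -/
lemma potential_Q_eq_eval_zonal (l : ℕ) (z : Fin n → Sph d)
    {w : Fin n → Euc d} (hw : w = fun i => (z i : Euc d)) {V : Submodule ℝ (Euc d)}
    (hV : V = (Submodule.span ℝ (Set.range w))ᗮ)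
    (b : OrthonormalBasis (Fin (d - n)) ℝ V) (x y : Sph d) :
    potential (Q d n l) z x y = (Matrix.gram ℝ w).det ^ l
      * eval (Sum.elim (projCoord b x) (projCoord b y)) (zonal (Fin (d - n)) l) := by
  subst hV hw
  rw [eval_zonal_projCoord, potential, Q_eq_gegHom, Fintype.card_fin]
  rfl

/-- For fixed last inputs the kernel is a nonnegative multiple of some `∑ g(x) g(y)` with `g`
continuous, and for `l ≥ 1` its mean in the first input is zero. Here dependent last inputs are
allowed: the kernel is then `0` or `1`. -/
lemma potential_Q_eq_sum (l : ℕ) (hk : n + 2 ≤ d + 1) (hl : n + 2 = d + 1 → l ≤ 1)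
    (z : Fin n → Sph d) :
    (∃ (κ : Type) (_ : Fintype κ) (c : ℝ) (g : κ → Sph d → ℝ), 0 ≤ c ∧
      (∀ m, Continuous (g m)) ∧
      ∀ x y, potential (Q d n l) z x y = c * ∑ m, g m x * g m y) ∧
    (1 ≤ l → ∀ y, ∫ x, potential (Q d n l) z x y ∂sigma d = 0) := by
  set w : Fin n → Euc d := fun i => (z i : Euc d) with hw
  have hlast (x y : Sph d) :
      lastInputs (Matrix.vecCons x (Matrix.vecCons y z) : Fin (n + 2) → Sph d) = w := by
    funext i
    simp [lastInputs, hw]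
  by_cases hind : LinearIndependent ℝ w
  · set V := (Submodule.span ℝ (Set.range w))ᗮ with hV
    have hfin : Module.finrank ℝ V = d - n := by
      have h := Submodule.finrank_add_finrank_orthogonal (Submodule.span ℝ (Set.range w))
      rw [finrank_span_eq_card hind, finrank_euclideanSpace, Fintype.card_fin,
        Fintype.card_fin, ← hV] at h
      omega
    let b : OrthonormalBasis (Fin (d - n)) ℝ V := (stdOrthonormalBasis ℝ V).reindex (finCongr hfin)
    have hdim : l ≤ 1 ∨ 2 ≤ Fintype.card (Fin (d - n)) := by
      rw [Fintype.card_fin]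
      omega
    have hpot := potential_Q_eq_eval_zonal l z hw hV b
    constructor
    · obtain ⟨κ, _, f, c, hc, -, hz⟩ := zonal_eq_sum (Fin (d - n)) l hdim
      refine ⟨κ, inferInstance, (Matrix.gram ℝ w).det ^ l * c,
        fun m x => eval (projCoord b x) (f m),
        mul_nonneg (pow_nonneg (Matrix.posSemidef_gram ℝ w).det_nonneg _) hc,
        fun m => continuous_eval_projCoord b (f m), fun x y => ?_⟩
      rw [hpot, hz]
      simp [eval_rename, mul_assoc]
    · intro h1 y
      have : Nonempty (Fin (d - n)) := ⟨⟨0, by omega⟩⟩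
      have hz := integral_zonal_eq_zero b h1 hdim (projCoord b y)
      have hsymm (x : Sph d) : potential (Q d n l) z x y = (Matrix.gram ℝ w).det ^ l
          * eval (Sum.elim (projCoord b y) (projCoord b x)) (zonal (Fin (d - n)) l) := by
        rw [hpot, eval_zonal_projCoord, eval_zonal_projCoord, real_inner_comm,
          mul_comm (‖V.starProjection (x : Euc d)‖ ^ 2)]
      simp only [hsymm]
      rw [integral_const_mul, hz, mul_zero]
  · -- dependent last inputs: the Gram determinant vanishes
    have hdet : (Matrix.gram ℝ w).det = 0 := by
      by_contra h
      exact hind (Matrix.det_gram_ne_zero_iff_linearIndependent.1 h)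
    rcases Nat.eq_zero_or_pos l with rfl | h1
    · refine ⟨⟨Unit, inferInstance, 1, fun _ _ => 1, zero_le_one, fun _ => continuous_const,
        fun x y => ?_⟩, fun h => by omega⟩
      simp [potential, Q, gegenbauer]
    · have hzero (x y : Sph d) : potential (Q d n l) z x y = 0 := by
        rw [potential, Q, hlast, hdet, zero_pow (by omega)]
        simp
      exact ⟨⟨Unit, inferInstance, 0, fun _ _ => 1, le_rfl, fun _ => continuous_const,
        fun x y => by simp [hzero]⟩, fun _ y => by simp [hzero]⟩

end Positive

/-! ### Energies -/

section Energy

variable {d n : ℕ}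

/-- Fubini's theorem for the energy, with the first two inputs integrated first. -/
lemma energy_eq_integral_potential {K : (Fin (n + 2) → Sph d) → ℝ} (hK : Continuous K)
    (μ : Measure (Sph d)) [IsFiniteMeasure μ] :
    energy K μ
      = ∫ z : Fin n → Sph d, ∫ y, ∫ x, potential K z x y ∂μ ∂μ ∂(Measure.pi fun _ => μ) := by
  have step {m : ℕ} {F : (Fin (m + 1) → Sph d) → ℝ} (hF : Continuous F) :
      ∫ x, F x ∂(Measure.pi fun _ => μ)
        = ∫ w : Fin m → Sph d, ∫ x, F (Matrix.vecCons x w) ∂μ ∂(Measure.pi fun _ => μ) := by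
    have mp := (measurePreserving_piFinSuccAbove (fun _ : Fin (m + 1) => μ) 0).symm
    rw [← mp.integral_comp' F]
    have hc : Continuous fun p : Sph d × (Fin m → Sph d) => F (Matrix.vecCons p.1 p.2) :=
      hF.comp (continuous_fst.matrixVecCons continuous_snd)
    have hint : Integrable (fun p : Sph d × (Fin m → Sph d) => F (Matrix.vecCons p.1 p.2))
        (μ.prod (Measure.pi fun _ => μ)) :=
      hc.integrable_of_hasCompactSupport (HasCompactSupport.of_compactSpace _)
    rw [← integral_prod_symm _ hint]
    refine integral_congr_ae (.of_forall fun p => congrArg F ?_)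
    exact Fin.insertNth_zero' p.1 p.2
  rw [energy, step hK]
  have hc : Continuous fun w : Fin (n + 1) → Sph d => ∫ x, K (Matrix.vecCons x w) ∂μ := by
    have := continuous_parametric_integral_of_continuous (μ := μ) (s := Set.univ)
      (f := fun (w : Fin (n + 1) → Sph d) x => K (Matrix.vecCons x w))
      (hK.comp (continuous_snd.matrixVecCons continuous_fst)) isCompact_univ
    simpa only [Measure.restrict_univ] using this
  rw [step hc]
  rfl

lemma energy_Q_nonneg {l : ℕ} (hk : n + 2 ≤ d + 1) (hl : n + 2 = d + 1 → l ≤ 1)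
    (μ : Measure (Sph d)) [IsFiniteMeasure μ] : 0 ≤ energy (Q d n l) μ := by
  rw [energy_eq_integral_potential (isPolynomialKernel_Q d n l).continuous]
  refine integral_nonneg fun z => ?_
  obtain ⟨⟨κ, _, c, g, hc, hg, hK⟩, -⟩ := potential_Q_eq_sum l hk hl z
  have hint (m : κ) : Integrable (g m) μ :=
    (hg m).integrable_of_hasCompactSupport (HasCompactSupport.of_compactSpace _)
  have h1 (y : Sph d) : ∫ x, potential (Q d n l) z x y ∂μ = c * ∑ m, (∫ x, g m x ∂μ) * g m y := by
    simp only [hK]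
    rw [integral_const_mul, integral_finsetSum _ fun m _ => (hint m).mul_const _]
    simp only [integral_mul_const]
  simp only [h1]
  rw [integral_const_mul, integral_finsetSum _ fun m _ => (hint m).const_mul _]
  simp only [integral_const_mul]
  exact mul_nonneg hc (Finset.sum_nonneg fun m _ => mul_self_nonneg _)

lemma energy_Q_sigma {l : ℕ} (h1 : 1 ≤ l) (hk : n + 2 ≤ d + 1) (hl : n + 2 = d + 1 → l ≤ 1) :
    energy (Q d n l) (sigma d) = 0 := by
  rw [energy_eq_integral_potential (isPolynomialKernel_Q d n l).continuous]
  simp [(potential_Q_eq_sum l hk hl _).2 h1]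

lemma isEnergyMinimizer_Q_sigma {l : ℕ} (hk : n + 2 ≤ d + 1) (hl : n + 2 = d + 1 → l ≤ 1) :
    IsEnergyMinimizer (Q d n l) (sigma d) := by
  have hσ := isProbabilityMeasure_sigma (d := d) (by omega)
  refine ⟨hσ, fun ν hν => ?_⟩
  rcases Nat.eq_zero_or_pos l with rfl | h1
  · -- the kernel is constant
    simp [energy, Q, gegenbauer]
  · rw [energy_Q_sigma h1 hk hl]
    exact energy_Q_nonneg hk hl ν

end Energy

end KPoint

end

theorem theorem6p1 (d n l : ℕ) (hk : n + 2 ≤ d + 1) (hl : n + 2 = d + 1 → l ≤ 1) :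
    KPoint.IsPolynomialKernel (KPoint.Q d n l) ∧
    KPoint.IsRotationInvariant (KPoint.Q d n l) ∧
    KPoint.IsKPositiveDefinite (KPoint.Q d n l) ∧
    KPoint.IsEnergyMinimizer (KPoint.Q d n l) (KPoint.sigma d) := by
  have hpoly := KPoint.isPolynomialKernel_Q d n l
  refine ⟨hpoly, hpoly.isRotationInvariant, ⟨hpoly.continuous, fun z => ?_⟩,
    KPoint.isEnergyMinimizer_Q_sigma hk hl⟩
  obtain ⟨⟨κ, _, c, g, hc, hg, hK⟩, -⟩ := KPoint.potential_Q_eq_sum l hk hl z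
  exact KPoint.isPositiveDefinite_of_eq_sum hc hg hK
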